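/- Let $\mathbb N=\{0,1,2,\dots\}$, $\mathbb N^\times=\mathbb N\setminus\{0\}$, and for $R\in\{\mathbb N,\mathbb Z\}$ let $R\rtimes\mathbb N^\times$ be the set $R\times\mathbb N^\times$ with the multiplication $(m,k)(n,l)=(m+kn,kl)$. Let $\Omega$ be the set of nonempty hereditary directed subsets of $P=\mathbb N\rtimes\mathbb N^\times$ for the order $x\le y\iff y\in xP$, with the topology of pointwise convergence of indicator functions (a compact Hausdorff space). The semigroup $P$ acts on $\Omega$: $x\omega$ is the smallest hereditary directed set containing $\{xy: y\in\omega\}$. Let $\widehat{\mathbb Z}=\prod_p\mathbb Z_p$ and, for $r,a\in\widehat{\mathbb Z}$, put $$B(r,a)=\{(m,k)\in P : a\in k\widehat{\mathbb Z},\ r-m\in k\widehat{\mathbb Z}\}\in\Omega ,$$ which depends only on the class of $a$ in $\widehat{\mathbb Z}/\widehat{\mathbb Z}^*$ and on the class of $r$ in $\widehat{\mathbb Z}/a\widehat{\mathbb Z}$. The additive boundary is the compact set $\Omega_B=\{B(r,a): r,a\in\widehat{\mathbb Z}\}\subset\Omega$. If a monoid $S$ acts on a compact Hausdorff space $X$ by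 injective continuous maps with open images, then $C(X)\rtimes S$ denotes the universal unital C$^*$-algebra generated by the image of a unital $*$-homomorphism $\iota$ of $C(X)$ and isometries $v_x$, $x\in S$, such that $v_xv_y=v_{xy}$ and $v_x\iota(f)v_x^*=\iota(f(x^{-1}\cdot))$, where $f(x^{-1}\omega)=f(\omega')$ if $\omega=x\omega'$ and $f(x^{-1}\omega)=0$ if $\omega\notin xX$. **Proposition.** The action of $\mathbb N\rtimes\mathbb N^\times$ on $\Omega$ leaves $\Omega_B$ invariant, and its restriction to $\Omega_B$ extends to an action of $\mathbb Z\rtimes\mathbb N^\times$ on $\Omega_B$ by injective continuous maps with open images, given by $(m,k)B(r,a)=B(m+kr,ka)$. Let $s=v_{(1,1)}\in C(\Omega)\rtimes(\mathbb N\rtimes\mathbb N^\times)$, and let $\langle1-ss^*\rangle$ be the closed two-sided ideal generated by $1-ss^*$. The restriction map $C(\Omega)\to C(\Omega_B)$, $f\mapsto f|_{\Omega_B}$, determines an isomorphism of C$^*$-algebras $$C(\Omega)\rtimes(\mathbb N\rtimes\mathbb N^\times)/\langle1-ss^*\rangle\;\cong\;C(\Omega_B)\rtimes(\mathbb Z\rtimes\mathbb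 N^\times),$$ which sends the class of $\iota(f)$ to $\iota(f|_{\Omega_B})$ for $f\in C(\Omega)$ and the class of $v_x$ to $v_x$ for $x\in\mathbb N\rtimes\mathbb N^\times$. -/

import Mathlib

open scoped ENNReal

universe u

/-- An action of a monoid `S` on a space `X` by injective continuous maps with open image. -/
structure OpenAction (S X : Type u) [Monoid S] [TopologicalSpace X] where
  act : S → X → X
  one_act : ∀ ω, act 1 ω = ω
  mul_act : ∀ x y ω, act (x * y) ω = act x (act y ω)
  isOpenEmbedding : ∀ x, Topology.IsOpenEmbedding (act x)

namespace OpenAction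

variable {S X : Type u} [Monoid S] [TopologicalSpace X] [CompactSpace X] [T2Space X]

/-- The function `f(x⁻¹ ·)`: its value at `x ω'` is `f ω'`, and it is `0` off `x X`. -/
noncomputable def push (α : OpenAction S X) (x : S) (f : C(X, ℂ)) : C(X, ℂ) where
  toFun := Function.extend (α.act x) f 0
  continuous_toFun := by
    have hx := α.isOpenEmbedding x
    rw [continuous_iff_continuousAt]
    intro ω
    by_cases hω : ω ∈ Set.range (α.act x)
    · obtain ⟨ω', rfl⟩ := hω
      rw [← hx.continuousAt_iff, Function.extend_comp hx.injective]
      exact f.continuous.continuousAt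
    · have hc : IsClosed (Set.range (α.act x)) := (isCompact_range hx.continuous).isClosed
      refine (continuousAt_const (y := (0 : ℂ))).congr ?_
      filter_upwards [hc.isOpen_compl.mem_nhds hω] with η hη
      rw [Function.extend_apply' _ _ _ hη]
      rfl

end OpenAction

/-- A covariant pair for `α` in a unital C*-algebra `A`: a unital `*`-homomorphism `π` of `C(X)`
and isometries `v x` with `v (x y) = v x v y` and `v x π(f) (v x)* = π(f(x⁻¹ ·))`. -/
structure CovariantRep {S X : Type u} [Monoid S] [TopologicalSpace X] [CompactSpace X]
    [T2Space X] (α : OpenAction S X) (A : Type u) [CStarAlgebra A] where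
  π : C(X, ℂ) →⋆ₐ[ℂ] A
  v : S → A
  isometry : ∀ x, star (v x) * v x = 1
  v_mul : ∀ x y, v (x * y) = v x * v y
  covariant : ∀ x f, v x * π f * star (v x) = π (α.push x f)

/-- The bounded sections of a family of nonzero unital C*-algebras form a unital C*-algebra. -/
noncomputable instance lpInftyCStarAlgebra {I : Type*} {A : I → Type*}
    [∀ i, CStarAlgebra (A i)] [∀ i, Nontrivial (A i)] : CStarAlgebra (lp A ∞) where

section CrossedProduct

variable {S X : Type u} [Monoid S] [TopologicalSpace X] [CompactSpace X] [T2Space X]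

/-- Evaluation of a covariant pair on noncommutative polynomials in symbols for the functions
`f ∈ C(X)`, the isometries `v x` and their adjoints. Its range is the `*`-algebra generated by the
pair. -/
noncomputable def CovariantRep.eval {α : OpenAction S X} {A : Type u} [CStarAlgebra A]
    (ρ : CovariantRep α A) : FreeAlgebra ℂ (C(X, ℂ) ⊕ S ⊕ S) →ₐ[ℂ] A :=
  FreeAlgebra.lift ℂ (Sum.elim ρ.π (Sum.elim ρ.v fun x => star (ρ.v x)))

/-- The functions `w ↦ ‖ρ(w)‖` on noncommutative polynomials that come from covariant pairs `ρ` in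
nonzero unital C*-algebras. They form a set, and such a function determines the covariant pair
up to isomorphism of the C*-algebra that it generates. -/
def OpenAction.RepNorm (α : OpenAction S X) : Type u :=
  {q : FreeAlgebra ℂ (C(X, ℂ) ⊕ S ⊕ S) → ℝ //
    ∃ (A : Type u) (_ : CStarAlgebra A) (_ : Nontrivial A) (ρ : CovariantRep α A),
      ∀ w, q w = ‖ρ.eval w‖}

namespace OpenAction.RepNorm
variable {α : OpenAction S X} (q : α.RepNorm)

/-- The C*-algebra of a covariant pair chosen for each such function. -/
def Alg : Type u := q.2.choose
noncomputable instance : CStarAlgebra q.Alg := q.2.choose_spec.choose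
instance : Nontrivial q.Alg := q.2.choose_spec.choose_spec.choose
/-- The chosen covariant pair. -/
noncomputable def rep : CovariantRep α q.Alg := q.2.choose_spec.choose_spec.choose_spec.choose
theorem norm_eval (w) : ‖q.rep.eval w‖ = q.1 w :=
  (q.2.choose_spec.choose_spec.choose_spec.choose_spec w).symm
end OpenAction.RepNorm

theorem CovariantRep.norm_v_le {α : OpenAction S X} {A : Type u} [CStarAlgebra A]
    (ρ : CovariantRep α A) [Nontrivial A] (x : S) : ‖ρ.v x‖ ≤ 1 := by
  have h := CStarRing.norm_star_mul_self (x := ρ.v x)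
  rw [ρ.isometry, CStarRing.norm_one] at h
  nlinarith [norm_nonneg (ρ.v x)]

variable (α : OpenAction S X)

/-- `f ↦ (π_q(f))_q`, over all the chosen covariant pairs `(π_q, v_q)`. -/
noncomputable def OpenAction.familyπ (f : C(X, ℂ)) : lp (fun q : α.RepNorm => q.Alg) ∞ :=
  ⟨fun q => q.rep.π f, memℓp_infty ⟨‖f‖, by
    rintro _ ⟨q, rfl⟩
    exact NonUnitalStarAlgHom.norm_apply_le _ f⟩⟩

/-- `x ↦ (v_q(x))_q`, over all the chosen covariant pairs `(π_q, v_q)`. -/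
noncomputable def OpenAction.familyv (x : S) : lp (fun q : α.RepNorm => q.Alg) ∞ :=
  ⟨fun q => q.rep.v x, memℓp_infty ⟨1, by
    rintro _ ⟨q, rfl⟩
    exact q.rep.norm_v_le x⟩⟩

/-- The C*-algebra generated by the direct sum of the chosen covariant pairs. -/
noncomputable def OpenAction.crossedProductSubalgebra : StarSubalgebra ℂ (lp (fun q : α.RepNorm => q.Alg) ∞) :=
  (StarAlgebra.adjoin ℂ (Set.range α.familyπ ∪ Set.range α.familyv)).topologicalClosure

/-- The semigroup crossed product `C(X) ⋊ S`: the universal unital C*-algebra generated by a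
covariant pair. The universal property is `OpenAction.existsUnique_lift` below, and generation is
`OpenAction.dense_canonical`. -/
def OpenAction.CrossedProduct : Type u := α.crossedProductSubalgebra

noncomputable instance : CStarAlgebra α.CrossedProduct :=
  StarSubalgebra.cstarAlgebra α.crossedProductSubalgebra
    (h_closed := StarSubalgebra.isClosed_topologicalClosure _)

namespace OpenAction

/-- The canonical covariant pair `(ι, v)` in the crossed product. -/
noncomputable def canonical : CovariantRep α α.CrossedProduct where
  π :=
    { toFun := fun f => ⟨α.familyπ f, StarSubalgebra.le_topologicalClosure _
        (StarAlgebra.subset_adjoin ℂ _ (Or.inl ⟨f, rfl⟩))⟩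
      map_one' := Subtype.ext <| Subtype.ext <| funext fun q => map_one q.rep.π
      map_mul' := fun f g => Subtype.ext <| Subtype.ext <| funext fun q => map_mul q.rep.π f g
      map_zero' := Subtype.ext <| Subtype.ext <| funext fun q => map_zero q.rep.π
      map_add' := fun f g => Subtype.ext <| Subtype.ext <| funext fun q => map_add q.rep.π f g
      commutes' := fun c => Subtype.ext <| Subtype.ext <| funext fun q =>
        AlgHomClass.commutes q.rep.π c
      map_star' := fun f => Subtype.ext <| Subtype.ext <| funext fun q => map_star q.rep.π f }
  v x := ⟨α.familyv x, StarSubalgebra.le_topologicalClosure _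
    (StarAlgebra.subset_adjoin ℂ _ (Or.inr ⟨x, rfl⟩))⟩
  isometry x := Subtype.ext <| Subtype.ext <| funext fun q => q.rep.isometry x
  v_mul x y := Subtype.ext <| Subtype.ext <| funext fun q => q.rep.v_mul x y
  covariant x f := Subtype.ext <| Subtype.ext <| funext fun q => q.rep.covariant x f

theorem canonical_eval_apply (w) (q : α.RepNorm) :
    α.crossedProductSubalgebra.subtype (α.canonical.eval w) q = q.rep.eval w := by
  let ev : α.CrossedProduct →ₐ[ℂ] q.Alg :=
    { toFun := fun b => (b : α.crossedProductSubalgebra).1.1 q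
      map_one' := rfl
      map_mul' := fun _ _ => rfl
      map_zero' := rfl
      map_add' := fun _ _ => rfl
      commutes' := fun _ => rfl }
  have : ev.comp α.canonical.eval = q.rep.eval := by
    apply FreeAlgebra.hom_ext
    funext g
    rcases g with f | x | x <;> simp [CovariantRep.eval] <;> rfl
  exact DFunLike.congr_fun this w

/-- The norm of the crossed product dominates every covariant pair. -/
theorem norm_eval_le {A : Type u} [CStarAlgebra A] (ρ : CovariantRep α A)
    (w : FreeAlgebra ℂ (C(X, ℂ) ⊕ S ⊕ S)) : ‖ρ.eval w‖ ≤ ‖α.canonical.eval w‖ := by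
  rcases subsingleton_or_nontrivial A with h | h
  · rw [Subsingleton.elim (ρ.eval w) 0, norm_zero]; exact norm_nonneg _
  · let q : α.RepNorm := ⟨fun w => ‖ρ.eval w‖, A, _, h, ρ, fun _ => rfl⟩
    have h1 : ‖ρ.eval w‖ = ‖q.rep.eval w‖ := (q.norm_eval w).symm
    rw [h1, ← α.canonical_eval_apply]
    exact lp.norm_apply_le_norm ENNReal.top_ne_zero _ q

theorem exists_eval_of_mem {A : Type u} [CStarAlgebra A] (ρ : CovariantRep α A) (a : A)
    (ha : a ∈ StarAlgebra.adjoin ℂ (Set.range ρ.π ∪ Set.range ρ.v)) : ∃ w, ρ.eval w = a := by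
  have hstar : ∀ {b : A}, b ∈ ρ.eval.range.carrier → star b ∈ ρ.eval.range.carrier := by
    rintro _ ⟨w, rfl⟩
    change star (ρ.eval w) ∈ ρ.eval.range
    induction w using FreeAlgebra.induction with
    | grade0 r =>
      rw [AlgHom.commutes, ← algebraMap_star_comm]
      exact Subalgebra.algebraMap_mem _ _
    | grade1 g =>
      rcases g with f | x | x
      · exact ⟨FreeAlgebra.ι ℂ (.inl (star f)), by simp [CovariantRep.eval, map_star]⟩
      · exact ⟨FreeAlgebra.ι ℂ (.inr (.inr x)), by simp [CovariantRep.eval]⟩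
      · exact ⟨FreeAlgebra.ι ℂ (.inr (.inl x)), by simp [CovariantRep.eval]⟩
    | mul a b ha hb => rw [map_mul, star_mul]; exact mul_mem hb ha
    | add a b ha hb => rw [map_add, star_add]; exact add_mem ha hb
  have hle : StarAlgebra.adjoin ℂ (Set.range ρ.π ∪ Set.range ρ.v) ≤
      (⟨ρ.eval.range, hstar⟩ : StarSubalgebra ℂ A) := by
    rw [StarAlgebra.adjoin_le_iff]
    rintro _ (⟨f, rfl⟩ | ⟨x, rfl⟩)
    · exact ⟨FreeAlgebra.ι ℂ (.inl f), by simp [CovariantRep.eval]⟩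
    · exact ⟨FreeAlgebra.ι ℂ (.inr (.inl x)), by simp [CovariantRep.eval]⟩
  exact hle ha

/-- The crossed product is generated by its canonical covariant pair. -/
theorem dense_canonical :
    Dense (StarAlgebra.adjoin ℂ (Set.range α.canonical.π ∪ Set.range α.canonical.v) :
      Set α.CrossedProduct) := by
  intro b
  let T := StarAlgebra.adjoin ℂ (Set.range α.canonical.π ∪ Set.range α.canonical.v)
  have key : ∀ c ∈ StarAlgebra.adjoin ℂ (Set.range α.familyπ ∪ Set.range α.familyv),
      c ∈ T.map α.crossedProductSubalgebra.subtype := by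
    intro c hc
    refine (StarAlgebra.adjoin_le_iff.mpr ?_ :
      StarAlgebra.adjoin ℂ (Set.range α.familyπ ∪ Set.range α.familyv) ≤ T.map α.crossedProductSubalgebra.subtype) hc
    rintro _ (⟨f, rfl⟩ | ⟨x, rfl⟩)
    · exact ⟨α.canonical.π f, StarAlgebra.subset_adjoin ℂ _ (Or.inl ⟨f, rfl⟩), rfl⟩
    · exact ⟨α.canonical.v x, StarAlgebra.subset_adjoin ℂ _ (Or.inr ⟨x, rfl⟩), rfl⟩
  change b ∈ closure (T : Set α.CrossedProduct)
  have hb : (b : α.crossedProductSubalgebra).1 ∈ closure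
      ((StarAlgebra.adjoin ℂ (Set.range α.familyπ ∪ Set.range α.familyv) : StarSubalgebra ℂ _) :
        Set (lp (fun q : α.RepNorm => q.Alg) ∞)) := (b : α.crossedProductSubalgebra).2
  rw [Metric.mem_closure_iff] at hb ⊢
  intro ε hε
  obtain ⟨c, hc, hd⟩ := hb ε hε
  obtain ⟨t, ht, rfl⟩ := key c hc
  exact ⟨t, ht, hd⟩

/-- The universal property: every covariant pair factors uniquely through the canonical one. -/
theorem existsUnique_lift {A : Type u} [CStarAlgebra A] (ρ : CovariantRep α A) :
    ∃! φ : α.CrossedProduct →⋆ₐ[ℂ] A,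
      (∀ f, φ (α.canonical.π f) = ρ.π f) ∧ ∀ x, φ (α.canonical.v x) = ρ.v x := by
  let T := StarAlgebra.adjoin ℂ (Set.range α.canonical.π ∪ Set.range α.canonical.v)
  let σ : CovariantRep α (α.CrossedProduct × A) :=
    { π := α.canonical.π.prod ρ.π
      v := fun x => (α.canonical.v x, ρ.v x)
      isometry := fun x => Prod.ext (α.canonical.isometry x) (ρ.isometry x)
      v_mul := fun x y => Prod.ext (α.canonical.v_mul x y) (ρ.v_mul x y)
      covariant := fun x f => Prod.ext (α.canonical.covariant x f) (ρ.covariant x f) }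
  have h1 : ∀ w, (σ.eval w).1 = α.canonical.eval w := fun w => by
    have : (AlgHom.fst ℂ _ _).comp σ.eval = α.canonical.eval := by
      apply FreeAlgebra.hom_ext
      funext g
      rcases g with f | x | x <;> simp [CovariantRep.eval, σ]
    exact DFunLike.congr_fun this w
  have h2 : ∀ w, (σ.eval w).2 = ρ.eval w := fun w => by
    have : (AlgHom.snd ℂ _ _).comp σ.eval = ρ.eval := by
      apply FreeAlgebra.hom_ext
      funext g
      rcases g with f | x | x <;> simp [CovariantRep.eval, σ]
    exact DFunLike.congr_fun this w
  let G := (StarAlgebra.adjoin ℂ (Set.range σ.π ∪ Set.range σ.v)).topologicalClosure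
  have hG : IsClosed (G : Set (α.CrossedProduct × A)) :=
    StarSubalgebra.isClosed_topologicalClosure _
  have hle : ∀ g ∈ G, ‖g.2‖ ≤ ‖g.1‖ := by
    have hc : IsClosed {g : α.CrossedProduct × A | ‖g.2‖ ≤ ‖g.1‖} :=
      isClosed_le (by fun_prop) (by fun_prop)
    intro g hg
    refine closure_minimal (fun g hg => ?_) hc hg
    obtain ⟨w, rfl⟩ := α.exists_eval_of_mem σ g hg
    simp only [Set.mem_ofPred_eq, h1, h2]
    exact α.norm_eval_le ρ w
  let p : G →⋆ₐ[ℂ] α.CrossedProduct := (StarAlgHom.fst ℂ _ _).comp G.subtype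
  have hinj : Function.Injective p := by
    rw [injective_iff_map_eq_zero]
    intro g hg
    have hg1 : (g : α.CrossedProduct × A).1 = 0 := hg
    have := hle g g.2
    rw [hg1, norm_zero, norm_le_zero_iff] at this
    exact Subtype.ext (Prod.ext hg1 this)
  have hsurj : Function.Surjective p := by
    have hcl : IsClosed (p.range : Set α.CrossedProduct) := by
      exact (NonUnitalStarAlgHom.isometry p hinj).isClosedEmbedding.isClosed_range
    have : (⊤ : StarSubalgebra ℂ α.CrossedProduct) ≤ p.range := by
      suffices h : T ≤ p.range from fun b _ => closure_minimal h hcl (α.dense_canonical b)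
      refine StarAlgebra.adjoin_le_iff.mpr ?_
      rintro _ (⟨f, rfl⟩ | ⟨x, rfl⟩)
      · exact ⟨⟨σ.π f, StarSubalgebra.le_topologicalClosure _
          (StarAlgebra.subset_adjoin ℂ _ (Or.inl ⟨f, rfl⟩))⟩, rfl⟩
      · exact ⟨⟨σ.v x, StarSubalgebra.le_topologicalClosure _
          (StarAlgebra.subset_adjoin ℂ _ (Or.inr ⟨x, rfl⟩))⟩, rfl⟩
    intro b
    exact this (Set.mem_univ b)
  let e := StarAlgEquiv.ofBijective p ⟨hinj, hsurj⟩
  let φ : α.CrossedProduct →⋆ₐ[ℂ] A :=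
    ((StarAlgHom.snd ℂ _ _).comp G.subtype).comp (e.symm : α.CrossedProduct →⋆ₐ[ℂ] G)
  have hφπ : ∀ f, φ (α.canonical.π f) = ρ.π f := fun f => by
    have : e.symm (α.canonical.π f) = ⟨σ.π f, StarSubalgebra.le_topologicalClosure _
        (StarAlgebra.subset_adjoin ℂ _ (Or.inl ⟨f, rfl⟩))⟩ := by
      rw [StarAlgEquiv.symm_apply_eq]; rfl
    change (e.symm (α.canonical.π f)).1.2 = _
    rw [this]; rfl
  have hφv : ∀ x, φ (α.canonical.v x) = ρ.v x := fun x => by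
    have : e.symm (α.canonical.v x) = ⟨σ.v x, StarSubalgebra.le_topologicalClosure _
        (StarAlgebra.subset_adjoin ℂ _ (Or.inr ⟨x, rfl⟩))⟩ := by
      rw [StarAlgEquiv.symm_apply_eq]; rfl
    change (e.symm (α.canonical.v x)).1.2 = _
    rw [this]
  have hcont : ∀ ψ : α.CrossedProduct →⋆ₐ[ℂ] A, Continuous ψ := fun ψ =>
    AddMonoidHomClass.continuous_of_bound ψ 1 fun b => by
      rw [one_mul]; exact NonUnitalStarAlgHom.norm_apply_le ψ b
  refine ⟨φ, ⟨hφπ, hφv⟩, fun ψ hψ => ?_⟩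
  apply DFunLike.coe_injective
  refine Continuous.ext_on α.dense_canonical (hcont ψ) (hcont φ) ?_
  refine StarAlgHom.adjoin_le_equalizer ψ φ ?_
  rintro _ (⟨f, rfl⟩ | ⟨x, rfl⟩)
  · rw [hψ.1, hφπ]
  · rw [hψ.2, hφv]

end OpenAction

end CrossedProduct

/-- The nonempty hereditary directed subsets of a monoid `S`, for the order
`x ≤ y ↔ y ∈ x S`, which Mathlib writes as left divisibility `x ∣ y`. -/
@[ext]
structure NicaSpectrum (S : Type u) [Monoid S] where
  carrier : Set S
  nonempty : carrier.Nonempty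
  hereditary : ∀ x y, x ∣ y → y ∈ carrier → x ∈ carrier
  directed : ∀ x ∈ carrier, ∀ y ∈ carrier, ∃ z ∈ carrier, x ∣ z ∧ y ∣ z

/-- Two elements with a common upper bound have a least common upper bound, for the order
`x ≤ y ↔ y ∈ x S`. -/
class HasLubs (S : Type u) [Monoid S] : Prop where
  exists_lub : ∀ x y z : S, x ∣ z → y ∣ z →
    ∃ w, x ∣ w ∧ y ∣ w ∧ ∀ t, x ∣ t → y ∣ t → w ∣ t

namespace NicaSpectrum

variable {S : Type u} [Monoid S]

open Classical in
/-- The indicator function of a hereditary directed set. -/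
noncomputable def indicator (ω : NicaSpectrum S) (x : S) : Bool := decide (x ∈ ω.carrier)

/-- The topology of pointwise convergence of indicator functions. -/
noncomputable instance : TopologicalSpace (NicaSpectrum S) := TopologicalSpace.induced indicator inferInstance

theorem isInducing_indicator : Topology.IsInducing (indicator (S := S)) := ⟨rfl⟩

theorem indicator_injective : Function.Injective (indicator (S := S)) := fun ω η h =>
  NicaSpectrum.ext <| Set.ext fun x => by simpa [indicator] using congrFun h x

theorem isClopen_mem (x : S) : IsClopen {ω : NicaSpectrum S | x ∈ ω.carrier} := by
  have : {ω : NicaSpectrum S | x ∈ ω.carrier} = (fun ω => indicator ω x) ⁻¹' {true} := by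
    ext ω; simp [indicator]
  rw [this]
  exact (isClopen_discrete {true}).preimage
    ((continuous_apply x).comp isInducing_indicator.continuous)

theorem continuous_of_isClopen {Y : Type*} [TopologicalSpace Y] (F : Y → NicaSpectrum S)
    (h : ∀ x, IsClopen {y | x ∈ (F y).carrier}) : Continuous F := by
  rw [isInducing_indicator.continuous_iff, continuous_pi_iff]
  intro x
  rw [continuous_bool_rng true]
  convert h x using 1
  ext y; simp [indicator]

instance : T2Space (NicaSpectrum S) :=
  T2Space.of_injective_continuous indicator_injective isInducing_indicator.continuous

theorem one_mem (ω : NicaSpectrum S) : 1 ∈ ω.carrier := by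
  obtain ⟨x, hx⟩ := ω.nonempty
  exact ω.hereditary 1 x ⟨x, (one_mul x).symm⟩ hx

theorem lub_mem (ω : NicaSpectrum S) {x y w : S} (hx : x ∈ ω.carrier) (hy : y ∈ ω.carrier)
    (hw : ∀ t, x ∣ t → y ∣ t → w ∣ t) : w ∈ ω.carrier := by
  obtain ⟨z, hz, hxz, hyz⟩ := ω.directed x hx y hy
  exact ω.hereditary w z (hw z hxz hyz) hz

instance [HasLubs S] : CompactSpace (NicaSpectrum S) := by
  have hr : Set.range (indicator (S := S)) =
      {f | f 1 = true} ∩ (⋂ (x : S) (y : S) (_ : x ∣ y), {f | f y = true → f x = true}) ∩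
      (⋂ (x : S) (y : S) (w : S) (_ : ∀ t, x ∣ t → y ∣ t → w ∣ t),
        {f | f x = true → f y = true → f w = true}) ∩
      (⋂ (x : S) (y : S) (_ : ¬ ∃ z, x ∣ z ∧ y ∣ z), {f | f x = true → f y = false}) := by
    ext f
    simp only [Set.mem_inter_iff, Set.mem_iInter, Set.mem_ofPred_eq]
    constructor
    · rintro ⟨ω, rfl⟩
      refine ⟨⟨⟨by simpa [indicator] using ω.one_mem, fun x y h => ?_⟩, fun x y w h => ?_⟩,
        fun x y h => ?_⟩
      · simpa [indicator] using ω.hereditary x y h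
      · simpa [indicator] using fun hx hy => ω.lub_mem hx hy h
      · simp only [indicator, decide_eq_true_eq, decide_eq_false_iff_not]
        intro hx hy
        obtain ⟨z, -, hz⟩ := ω.directed x hx y hy
        exact h ⟨z, hz⟩
    · rintro ⟨⟨⟨h1, h2⟩, h3⟩, h4⟩
      refine ⟨⟨{x | f x = true}, ⟨1, h1⟩, h2, fun x hx y hy => ?_⟩, ?_⟩
      · by_cases h : ∃ z, x ∣ z ∧ y ∣ z
        · obtain ⟨z, hxz, hyz⟩ := h
          obtain ⟨w, hxw, hyw, hw⟩ := HasLubs.exists_lub x y z hxz hyz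
          exact ⟨w, h3 x y w hw hx hy, hxw, hyw⟩
        · have := h4 x y h hx
          simp_all
      · funext x; simp [indicator]
  have hc : IsClosed (Set.range (indicator (S := S))) := by
    have e : ∀ x : S, Continuous fun f : S → Bool => f x := continuous_apply
    have c : ∀ (x : S) (b : Bool), IsClopen {f : S → Bool | f x = b} := fun x b =>
      (isClopen_discrete {b}).preimage (e x)
    rw [hr]
    refine (((c 1 true).isClosed.inter ?_).inter ?_).inter ?_
    · exact isClosed_iInter fun x => isClosed_iInter fun y => isClosed_iInter fun _ =>
        isClosed_imp (c y true).isOpen (c x true).isClosed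
    · exact isClosed_iInter fun x => isClosed_iInter fun y => isClosed_iInter fun w =>
        isClosed_iInter fun _ => isClosed_imp (c x true).isOpen
          (isClosed_imp (c y true).isOpen (c w true).isClosed)
    · exact isClosed_iInter fun x => isClosed_iInter fun y => isClosed_iInter fun _ =>
        isClosed_imp (c x true).isOpen (c y false).isClosed
  rw [← isCompact_univ_iff, isInducing_indicator.isCompact_iff, Set.image_univ]
  exact hc.isCompact

/-- The smallest hereditary directed set containing `x ω`. -/
def translate (x : S) (ω : NicaSpectrum S) : NicaSpectrum S where
  carrier := {y | ∃ z ∈ ω.carrier, y ∣ x * z}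
  nonempty := ⟨x * 1, 1, ω.one_mem, dvd_rfl⟩
  hereditary := fun y y' h ⟨z, hz, hy⟩ => ⟨z, hz, h.trans hy⟩
  directed := by
    rintro y ⟨z, hz, hy⟩ y' ⟨z', hz', hy'⟩
    obtain ⟨t, ht, h, h'⟩ := ω.directed z hz z' hz'
    exact ⟨x * t, ⟨t, ht, dvd_rfl⟩, hy.trans (mul_dvd_mul_left x h),
      hy'.trans (mul_dvd_mul_left x h')⟩

theorem mul_mem_translate [IsLeftCancelMul S] (x : S) (ω : NicaSpectrum S) (z : S) :
    x * z ∈ (translate x ω).carrier ↔ z ∈ ω.carrier := by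
  refine ⟨?_, fun h => ⟨z, h, dvd_rfl⟩⟩
  rintro ⟨t, ht, c, hc⟩
  rw [mul_assoc] at hc
  exact ω.hereditary z t ⟨c, mul_left_cancel hc⟩ ht

theorem isOpenEmbedding_translate [IsLeftCancelMul S] [HasLubs S] (x : S) :
    Topology.IsOpenEmbedding (translate x) := by
  have hinj : Function.Injective (translate x) := fun ω η h => by
    refine NicaSpectrum.ext <| Set.ext fun z => ?_
    rw [← mul_mem_translate x, h, mul_mem_translate]
  have hcont : Continuous (translate x) := by
    refine continuous_of_isClopen _ fun y => ?_
    by_cases h : ∃ z, x ∣ z ∧ y ∣ z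
    · obtain ⟨z, hxz, hyz⟩ := h
      obtain ⟨w, ⟨w', rfl⟩, hyw, hw⟩ := HasLubs.exists_lub x y z hxz hyz
      convert isClopen_mem w' using 1
      ext ω
      constructor
      · rintro ⟨t, ht, hyt⟩
        rw [Set.mem_ofPred_eq, ← mul_mem_translate x]
        exact ⟨t, ht, hw _ ⟨t, rfl⟩ hyt⟩
      · exact fun h => ⟨w', h, hyw⟩
    · convert isClopen_empty using 1
      refine Set.eq_empty_of_forall_notMem ?_
      rintro ω ⟨t, -, ht⟩
      exact h ⟨x * t, ⟨t, rfl⟩, ht⟩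
  refine ⟨(hcont.isClosedEmbedding hinj).isEmbedding, ?_⟩
  convert (isClopen_mem x).isOpen using 1
  ext ω
  constructor
  · rintro ⟨η, rfl⟩
    exact ⟨1, η.one_mem, 1, by simp⟩
  · intro hx
    refine ⟨⟨{z | x * z ∈ ω.carrier}, ⟨1, by simpa using hx⟩,
      fun y z h hz => ω.hereditary _ _ (mul_dvd_mul_left x h) hz, fun y hy z hz => ?_⟩, ?_⟩
    · obtain ⟨t, ht, ⟨c, rfl⟩, c', hc'⟩ := ω.directed _ hy _ hz
      rw [mul_assoc] at ht hc'
      rw [mul_assoc] at hc'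
      exact ⟨y * c, ht, ⟨c, rfl⟩, c', mul_left_cancel hc'⟩
    · refine NicaSpectrum.ext <| Set.ext fun y => ⟨?_, fun hy => ?_⟩
      · rintro ⟨z, hz, hy⟩
        exact ω.hereditary _ _ hy hz
      · obtain ⟨t, ht, ⟨c, rfl⟩, hyt⟩ := ω.directed _ hx _ hy
        exact ⟨c, ht, hyt⟩

/-- The action of `S` on its spectrum: `x` sends `ω` to the smallest hereditary directed set
containing `x ω`. -/
def openAction (S : Type u) [Monoid S] [IsLeftCancelMul S] [HasLubs S] :
    OpenAction S (NicaSpectrum S) where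
  act := translate
  one_act ω := by
    refine NicaSpectrum.ext <| Set.ext fun y => ⟨?_, fun hy => ⟨y, hy, by simp⟩⟩
    rintro ⟨z, hz, hy⟩
    exact ω.hereditary y z (by simpa using hy) hz
  mul_act x y ω := by
    refine NicaSpectrum.ext <| Set.ext fun t => ⟨?_, ?_⟩
    · rintro ⟨z, hz, ht⟩
      exact ⟨y * z, ⟨z, hz, dvd_rfl⟩, by rwa [← mul_assoc]⟩
    · rintro ⟨z, ⟨z', hz', hz⟩, ht⟩
      exact ⟨z', hz', ht.trans (by rw [mul_assoc]; exact mul_dvd_mul_left x hz)⟩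
  isOpenEmbedding := isOpenEmbedding_translate

end NicaSpectrum

/-- The semidirect product `R ⋊ ℕ^×`, of elements `(m, k)` with `m = add` in `R` and `k = mul` in
`ℕ^×`, and the multiplication `(m, k)(n, l) = (m + k n, k l)`. -/
@[ext]
structure AffineMonoid (R : Type) where
  add : R
  mul : ℕ+

namespace AffineMonoid

instance (R : Type) [CommSemiring R] : Monoid (AffineMonoid R) where
  mul x y := ⟨x.add + (x.mul : ℕ) * y.add, x.mul * y.mul⟩
  one := ⟨0, 1⟩
  mul_assoc x y z := by
    apply AffineMonoid.ext
    · change x.add + (x.mul : ℕ) * y.add + ((x.mul * y.mul : ℕ+) : ℕ) * z.add =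
        x.add + (x.mul : ℕ) * (y.add + (y.mul : ℕ) * z.add)
      push_cast; ring
    · exact mul_assoc _ _ _
  one_mul x := by
    apply AffineMonoid.ext
    · change (0 : R) + (((1 : ℕ+) : ℕ) : R) * x.add = x.add
      simp
    · exact one_mul _
  mul_one x := by
    apply AffineMonoid.ext
    · change x.add + (x.mul : ℕ) * (0 : R) = x.add
      simp
    · exact mul_one _

@[simp] theorem add_mul' {R : Type} [CommSemiring R] (x y : AffineMonoid R) :
    (x * y).add = x.add + (x.mul : ℕ) * y.add := rfl
@[simp] theorem mul_mul' {R : Type} [CommSemiring R] (x y : AffineMonoid R) :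
    (x * y).mul = x.mul * y.mul := rfl

instance : IsLeftCancelMul (AffineMonoid ℕ) where
  mul_left_cancel x y z h := by
    have h1 := congrArg AffineMonoid.add h
    have h2 := congrArg AffineMonoid.mul h
    simp only [add_mul', mul_mul', add_right_inj] at h1 h2
    refine AffineMonoid.ext ?_ (mul_left_cancel h2)
    exact Nat.eq_of_mul_eq_mul_left x.mul.pos (by simpa using h1)

theorem dvd_iff (x y : AffineMonoid ℕ) :
    x ∣ y ↔ x.mul ∣ y.mul ∧ ∃ n, y.add = x.add + x.mul * n := by
  constructor
  · rintro ⟨z, rfl⟩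
    exact ⟨⟨z.mul, rfl⟩, z.add, rfl⟩
  · rintro ⟨⟨c, hc⟩, n, hn⟩
    exact ⟨⟨n, c⟩, AffineMonoid.ext hn hc⟩

theorem exists_add_iff (m k t : ℕ) : (∃ n, t = m + k * n) ↔ m ≤ t ∧ t ≡ m [MOD k] := by
  constructor
  · rintro ⟨n, rfl⟩
    exact ⟨by omega, by simp [Nat.ModEq]⟩
  · rintro ⟨h, h'⟩
    obtain ⟨n, hn⟩ := (Nat.modEq_iff_dvd' h).mp h'.symm
    exact ⟨n, by omega⟩

instance : HasLubs (AffineMonoid ℕ) where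
  exists_lub x y z hx hy := by
    rw [dvd_iff, exists_add_iff] at hx hy
    have hex : ∃ t, (x.add ≤ t ∧ t ≡ x.add [MOD x.mul]) ∧ (y.add ≤ t ∧ t ≡ y.add [MOD y.mul]) :=
      ⟨z.add, hx.2, hy.2⟩
    classical
    obtain ⟨h1, h2⟩ := Nat.find_spec hex
    refine ⟨⟨Nat.find hex, PNat.lcm x.mul y.mul⟩, ?_, ?_, fun t hxt hyt => ?_⟩
    · rw [dvd_iff, exists_add_iff]; exact ⟨PNat.dvd_lcm_left _ _, h1⟩
    · rw [dvd_iff, exists_add_iff]; exact ⟨PNat.dvd_lcm_right _ _, h2⟩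
    · rw [dvd_iff, exists_add_iff] at hxt hyt ⊢
      refine ⟨PNat.lcm_dvd hxt.1 hyt.1, Nat.find_min' hex ⟨hxt.2, hyt.2⟩, ?_⟩
      rw [PNat.lcm_coe]
      have e1 := (hxt.2.2.trans h1.2.symm).dvd
      have e2 := (hyt.2.2.trans h2.2.symm).dvd
      exact Nat.modEq_of_dvd (Int.natCast_dvd.mpr
        (Nat.lcm_dvd (Int.natCast_dvd.mp e1) (Int.natCast_dvd.mp e2)))

/-- The inclusion of `ℕ ⋊ ℕ^×` in `ℤ ⋊ ℕ^×`. -/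
def toInt (x : AffineMonoid ℕ) : AffineMonoid ℤ := ⟨x.add, x.mul⟩

end AffineMonoid

/-- Primes are prime, as an instance. -/
instance factPrime (p : Nat.Primes) : Fact (p : ℕ).Prime := ⟨p.2⟩

/-- The ring `Ẑ = ∏ₚ ℤₚ`. -/
abbrev ZHat : Type := ∀ p : Nat.Primes, ℤ_[p]

namespace ZHat

theorem natCast_mul_left_cancel {k : ℕ} (hk : k ≠ 0) {a b : ZHat}
    (h : (k : ZHat) * a = (k : ZHat) * b) : a = b := by
  funext p
  have := congrFun h p
  simpa [hk] using this

theorem prime_dvd_iff (p : Nat.Primes) (a : ZHat) : ((p : ℕ) : ZHat) ∣ a ↔ ((p : ℕ) : ℤ_[p]) ∣ a p := by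
  constructor
  · rintro ⟨c, rfl⟩
    exact ⟨c p, by simp⟩
  · intro h
    have h' : ∀ q, (((p : ℕ) : ZHat) q) ∣ a q := fun q => by
      rw [Pi.natCast_apply]
      by_cases hq : q = p
      · subst hq; exact h
      · refine IsUnit.dvd ?_
        rw [PadicInt.isUnit_iff]
        refine le_antisymm (PadicInt.norm_le_one _) (not_lt.mp fun hlt => ?_)
        have := (PadicInt.norm_int_lt_one_iff_dvd (p := q) ((p : ℕ) : ℤ)).mp (by exact_mod_cast hlt)
        rw [Int.natCast_dvd_natCast, Nat.prime_dvd_prime_iff_eq q.2 p.2] at this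
        exact hq (Subtype.ext this)
    choose c hc using h'
    exact ⟨c, funext hc⟩

theorem dvd_int {k : ℕ} (hk : k ≠ 0) : ∀ {z : ℤ}, (k : ZHat) ∣ (z : ZHat) → (k : ℤ) ∣ z := by
  induction k using induction_on_primes with
  | zero => exact absurd rfl hk
  | one => intro z _; simp
  | prime_mul p a hp ih =>
    intro z h
    obtain ⟨P, rfl⟩ : ∃ P : Nat.Primes, (P : ℕ) = p := ⟨⟨p, hp⟩, rfl⟩
    have h1 : ((P : ℕ) : ZHat) ∣ (z : ZHat) := (Dvd.intro _ (by push_cast; rfl)).trans h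
    have h2 := (prime_dvd_iff P _).mp h1
    have h3 : ((P : ℕ) : ℤ) ∣ z := by
      rw [← PadicInt.norm_int_lt_one_iff_dvd (p := P),
        PadicInt.norm_lt_one_iff_dvd]
      simpa using h2
    obtain ⟨z', rfl⟩ := h3
    obtain ⟨c, hc⟩ := h
    have h4 : (z' : ZHat) = (a : ZHat) * c := by
      apply natCast_mul_left_cancel hp.ne_zero
      push_cast at hc
      rw [hc, mul_assoc]
    have := ih (right_ne_zero_of_mul hk) ⟨c, h4⟩
    push_cast
    exact mul_dvd_mul_left _ this

theorem exists_nat {k : ℕ} (hk : k ≠ 0) : ∀ r : ZHat, ∃ t : ℕ, (k : ZHat) ∣ r - (t : ZHat) := by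
  induction k using induction_on_primes with
  | zero => exact absurd rfl hk
  | one => intro r; exact ⟨0, by simp⟩
  | prime_mul p a hp ih =>
    intro r
    obtain ⟨P, rfl⟩ : ∃ P : Nat.Primes, (P : ℕ) = p := ⟨⟨p, hp⟩, rfl⟩
    have h1 : ((P : ℕ) : ZHat) ∣ r - (((r P).zmodRepr : ℕ) : ZHat) := by
      refine (prime_dvd_iff P _).mpr ?_
      have := PadicInt.sub_zmodRepr_mem (r P)
      rw [PadicInt.maximalIdeal_eq_span_p, Ideal.mem_span_singleton] at this
      simpa using this
    obtain ⟨c, hc⟩ := h1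
    obtain ⟨t, d, hd⟩ := ih (right_ne_zero_of_mul hk) c
    refine ⟨(r P).zmodRepr + (P : ℕ) * t, d, ?_⟩
    push_cast
    linear_combination hc + ((P : ℕ) : ZHat) * hd

theorem natCast_dvd {k : ℕ} (hk : k ≠ 0) {t : ℕ} (h : (k : ZHat) ∣ (t : ZHat)) : k ∣ t := by
  have := dvd_int hk (z := (t : ℤ)) (by simpa using h)
  exact_mod_cast this

theorem natCast_dvd_of_dvd {k l : ℕ} (h : k ∣ l) : (k : ZHat) ∣ (l : ZHat) := by
  obtain ⟨c, rfl⟩ := h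
  exact ⟨c, by push_cast; rfl⟩

theorem lcm_dvd {k l : ℕ} (hk : k ≠ 0) (hl : l ≠ 0) {a : ZHat} (hka : (k : ZHat) ∣ a)
    (hla : (l : ZHat) ∣ a) : ((Nat.lcm k l : ℕ) : ZHat) ∣ a := by
  obtain ⟨t, ht⟩ := exists_nat (Nat.lcm_ne_zero hk hl) a
  have h : ∀ {m : ℕ}, m ≠ 0 → m ∣ Nat.lcm k l → (m : ZHat) ∣ a → m ∣ t := fun hm hml hma =>
    natCast_dvd hm ((dvd_sub_right hma).mp ((natCast_dvd_of_dvd hml).trans ht))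
  have h3 := Nat.lcm_dvd (h hk (Nat.dvd_lcm_left k l) hka) (h hl (Nat.dvd_lcm_right k l) hla)
  have := dvd_add ht (natCast_dvd_of_dvd h3)
  rwa [sub_add_cancel] at this

theorem isClopen_dvd {k : ℕ} (hk : k ≠ 0) : IsClopen {a : ZHat | (k : ZHat) ∣ a} := by
  have hc : IsClosed {a : ZHat | (k : ZHat) ∣ a} := by
    have : {a : ZHat | (k : ZHat) ∣ a} = Set.range fun c : ZHat => (k : ZHat) * c := by
      ext a; exact ⟨fun ⟨c, hc⟩ => ⟨c, hc.symm⟩, fun ⟨c, hc⟩ => ⟨c, hc.symm⟩⟩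
    rw [this]
    exact (isCompact_range (continuous_const.mul continuous_id)).isClosed
  refine ⟨hc, ?_⟩
  rw [← isClosed_compl_iff]
  have : {a : ZHat | (k : ZHat) ∣ a}ᶜ = ⋃ t ∈ {t : ℕ | t < k ∧ ¬ k ∣ t},
      {a : ZHat | (k : ZHat) ∣ a - (t : ZHat)} := by
    ext a
    simp only [Set.mem_compl_iff, Set.mem_ofPred_eq, Set.mem_iUnion, exists_prop]
    constructor
    · intro ha
      obtain ⟨t, ht⟩ := exists_nat hk a
      have h1 : (k : ZHat) ∣ a - ((t % k : ℕ) : ZHat) := by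
        have h2 : (t : ZHat) = (k : ZHat) * ((t / k : ℕ) : ZHat) + ((t % k : ℕ) : ZHat) := by
          exact_mod_cast congrArg (Nat.cast : ℕ → ZHat) (Nat.div_add_mod t k).symm
        have h3 : a - ((t % k : ℕ) : ZHat) = (a - t) + (k : ZHat) * ((t / k : ℕ) : ZHat) := by
          rw [h2]; ring
        rw [h3]
        exact dvd_add ht (dvd_mul_right _ _)
      refine ⟨t % k, ⟨Nat.mod_lt _ (Nat.pos_of_ne_zero hk), fun hd => ha ?_⟩, h1⟩
      have := dvd_add h1 (natCast_dvd_of_dvd hd)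
      rwa [sub_add_cancel] at this
    · rintro ⟨t, ⟨-, ht⟩, h⟩ ha
      exact ht (natCast_dvd hk ((dvd_sub_right ha).mp h))
  rw [this]
  exact ((Set.finite_lt_nat k).subset fun t ht => ht.1).isClosed_biUnion fun t _ =>
    hc.preimage (continuous_id.sub continuous_const)

end ZHat

/-- The hereditary directed set `B(r, a) = {(m, k) | a ∈ k Ẑ and r - m ∈ k Ẑ}`. It depends on `a`
only modulo the units of `Ẑ` and on `r` only modulo `a Ẑ`. -/
def typeB (r a : ZHat) : NicaSpectrum (AffineMonoid ℕ) where
  carrier := {x | ((x.mul : ℕ) : ZHat) ∣ a ∧ ((x.mul : ℕ) : ZHat) ∣ r - (x.add : ZHat)}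
  nonempty := ⟨⟨0, 1⟩, by simp⟩
  hereditary := by
    rintro x y hxy ⟨ha, hr⟩
    rw [AffineMonoid.dvd_iff] at hxy
    obtain ⟨h, n, hn⟩ := hxy
    have hd := ZHat.natCast_dvd_of_dvd (PNat.dvd_iff.mp h)
    refine ⟨hd.trans ha, ?_⟩
    have : r - (x.add : ZHat) = (r - (y.add : ZHat)) + ((x.mul : ℕ) : ZHat) * (n : ZHat) := by
      rw [hn]; push_cast; ring
    rw [this]
    exact dvd_add (hd.trans hr) (dvd_mul_right _ _)
  directed := by
    rintro x ⟨hax, hrx⟩ y ⟨hay, hry⟩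
    have hl : Nat.lcm x.mul y.mul ≠ 0 := Nat.lcm_ne_zero x.mul.ne_zero y.mul.ne_zero
    obtain ⟨t, ht⟩ := ZHat.exists_nat hl r
    let T := t + Nat.lcm x.mul y.mul * (x.add + y.add)
    have hT : ((Nat.lcm x.mul y.mul : ℕ) : ZHat) ∣ r - (T : ZHat) := by
      have : r - (T : ZHat) = (r - t) -
          ((Nat.lcm x.mul y.mul : ℕ) : ZHat) * ((x.add + y.add : ℕ) : ZHat) := by
        simp only [T]; push_cast; ring
      rw [this]
      exact dvd_sub ht (dvd_mul_right _ _)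
    have hTle : x.add + y.add ≤ T :=
      (Nat.le_mul_of_pos_left _ (Nat.pos_of_ne_zero hl)).trans (Nat.le_add_left _ _)
    have key : ∀ w : AffineMonoid ℕ, (w.mul : ℕ) ∣ Nat.lcm x.mul y.mul → w.add ≤ T →
        ((w.mul : ℕ) : ZHat) ∣ r - (w.add : ZHat) → ∃ n, T = w.add + w.mul * n := by
      intro w hw hle hr
      have h1 : ((w.mul : ℕ) : ZHat) ∣ ((T - w.add : ℕ) : ZHat) := by
        rw [Nat.cast_sub hle]
        have := dvd_sub hr ((ZHat.natCast_dvd_of_dvd hw).trans hT)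
        rwa [sub_sub_sub_cancel_left] at this
      obtain ⟨n, hn⟩ := ZHat.natCast_dvd w.mul.ne_zero h1
      exact ⟨n, by omega⟩
    refine ⟨⟨T, PNat.lcm x.mul y.mul⟩, ⟨?_, ?_⟩, ?_, ?_⟩
    · rw [PNat.lcm_coe]
      exact ZHat.lcm_dvd x.mul.ne_zero y.mul.ne_zero hax hay
    · rw [PNat.lcm_coe]
      exact hT
    · rw [AffineMonoid.dvd_iff]
      exact ⟨PNat.dvd_lcm_left _ _, key x (Nat.dvd_lcm_left _ _) (by omega) hrx⟩
    · rw [AffineMonoid.dvd_iff]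
      exact ⟨PNat.dvd_lcm_right _ _, key y (Nat.dvd_lcm_right _ _) (by omega) hry⟩

theorem continuous_typeB : Continuous fun q : ZHat × ZHat => typeB q.1 q.2 := by
  refine NicaSpectrum.continuous_of_isClopen _ fun x => ?_
  exact ((ZHat.isClopen_dvd x.mul.ne_zero).preimage continuous_snd).inter
    ((ZHat.isClopen_dvd x.mul.ne_zero).preimage (continuous_fst.sub continuous_const))

/-- The additive boundary `Ω_B`: the points `B(r, a)` of the spectrum `Ω` of `ℕ ⋊ ℕ^×`, with `r` and
`a` in `Ẑ`. -/
def additiveBoundary : Set (NicaSpectrum (AffineMonoid ℕ)) :=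
  Set.range fun q : ZHat × ZHat => typeB q.1 q.2

instance : CompactSpace additiveBoundary :=
  isCompact_iff_compactSpace.mp (isCompact_range continuous_typeB)

/-- The closed two-sided ideal generated by an element: the smallest one containing it. -/
def closedIdeal {A : Type*} [CStarAlgebra A] (a : A) : TwoSidedIdeal A :=
  sInf {J : TwoSidedIdeal A | IsClosed (J : Set A) ∧ a ∈ J}

/-- The projection `1 - s s*` in `C(Ω) ⋊ (ℕ ⋊ ℕ^×)`, where `s` is the isometry of `(1, 1)`. -/
noncomputable def defectProjection :
    (NicaSpectrum.openAction (AffineMonoid ℕ)).CrossedProduct :=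
  1 - (NicaSpectrum.openAction (AffineMonoid ℕ)).canonical.v ⟨1, 1⟩ *
    star ((NicaSpectrum.openAction (AffineMonoid ℕ)).canonical.v ⟨1, 1⟩)

/-! Restriction of functions to `additiveBoundary` is equivariant (`push_restrict`), so the
canonical pair of the boundary crossed product restricts to a covariant pair over the whole
spectrum. The universal property then gives a `*`-homomorphism φ between the crossed products. It is
surjective: its range is closed, functions on the boundary extend to Ω, and the isometry of (-n, 1)
is the adjoint of that of (n, 1).

The point is that ker φ is exactly the closed ideal J generated by 1 - ss*. J lies in the kernel
because (1, 1) is invertible in ℤ ⋊ ℕ^×, so φ(s) is unitary. For the converse, pass to the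
C*-algebra quotient by J, where s becomes unitary. Conjugating 1 - ss* by the isometry of x puts the
indicator of xΩ minus that of x(1,1)Ω into J. The common zeros of these functions are the ω stable
under x ↦ x(1,1), and all such ω lie in the boundary (`mem_additiveBoundary_of_forall_mul_mem`).
Hence J contains every function vanishing on the boundary (`canonical_mem_closedIdeal`). The pair in
the quotient therefore factors through the boundary, and unitarity of s lets it extend to ℤ ⋊ ℕ^×
(`exists_covariantRep_boundary`). The quotient map thus factors through φ, so ker φ is contained in
J. -/

/-! ### Quotients of C*-algebras and their norms -/

section Quotient

variable {A : Type u} [CStarAlgebra A]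

/-- Multiplying `a` by a function of `a* a`: the norm is controlled on the spectrum of `a* a`. -/
theorem norm_mul_cfc_star_mul_self_sq_le (a : A) {g : ℝ → ℝ} {c : ℝ}
    (hg : ContinuousOn g (spectrum ℝ (star a * a))) (hc : 0 ≤ c)
    (h : ∀ t, 0 ≤ t → t * g t ^ 2 ≤ c) : ‖a * cfc g (star a * a)‖ ^ 2 ≤ c := by
  have hsa : IsSelfAdjoint (star a * a) := .star_mul_self a
  have hs : star (cfc g (star a * a)) = cfc g (star a * a) :=
    (cfc_predicate g (star a * a) : IsSelfAdjoint _)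
  -- By the C*-identity the squared norm is that of g(a*a) a*a g(a*a), which is the function t g(t)²
  -- of a*a.
  have h1 : star (a * cfc g (star a * a)) * (a * cfc g (star a * a)) =
      cfc (fun t => g t * (t * g t)) (star a * a) := by
    rw [cfc_mul g (fun t => t * g t) _ hg (continuousOn_id.mul hg),
      cfc_mul (fun t => t) g _ continuousOn_id hg, cfc_id' ℝ (star a * a), star_mul, hs]
    simp only [mul_assoc]
  rw [sq, ← CStarRing.norm_star_mul_self, h1]
  refine norm_cfc_le hc fun t ht => ?_
  have h0 := spectrum_star_mul_self_nonneg t ht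
  have h2 : g t * (t * g t) = t * g t ^ 2 := by ring
  rw [h2, Real.norm_of_nonneg (by positivity)]
  exact h t h0

/-- Here 1 - u plays the role of an approximate unit for the single element j. Take u = δ(δ + j*j)⁻¹
with δ = ε²/2: then 1 - u = (δ + j*j)⁻¹ j*j is a left multiple of j, and ‖ju‖² ≤ δ because t δ²/(δ +
t)² ≤ δ for t ≥ 0. -/
theorem exists_mul_mem_of_mem_ideal (I : Ideal A) {j : A} (hj : j ∈ I) {ε : ℝ} (hε : 0 < ε) :
    ∃ u : A, ‖u‖ ≤ 1 ∧ IsSelfAdjoint u ∧ 1 - u ∈ I ∧ ‖j * u‖ < ε := by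
  have hsa : IsSelfAdjoint (star j * j) := .star_mul_self j
  have hδ : 0 < ε ^ 2 / 2 := by positivity
  set δ := ε ^ 2 / 2 with hδ'
  have hne : ∀ t ∈ spectrum ℝ (star j * j), δ + t ≠ 0 := fun t ht => by
    have := spectrum_star_mul_self_nonneg t ht
    positivity
  have hd : ContinuousOn (fun t : ℝ => δ + t) (spectrum ℝ (star j * j)) := by fun_prop
  have hg : ContinuousOn (fun t : ℝ => δ / (δ + t)) (spectrum ℝ (star j * j)) :=
    continuousOn_const.div hd hne
  have hi : ContinuousOn (fun t : ℝ => 1 / (δ + t)) (spectrum ℝ (star j * j)) :=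
    continuousOn_const.div hd hne
  refine ⟨cfc (fun t : ℝ => δ / (δ + t)) (star j * j), ?_, cfc_predicate _ _, ?_, ?_⟩
  · refine norm_cfc_le zero_le_one fun t ht => ?_
    have := spectrum_star_mul_self_nonneg t ht
    rw [Real.norm_of_nonneg (by positivity)]
    exact div_le_one_of_le₀ (by linarith) (by linarith)
  · have : 1 - cfc (fun t : ℝ => δ / (δ + t)) (star j * j) =
        cfc (fun t : ℝ => 1 / (δ + t)) (star j * j) * (star j * j) := by
      have h : cfc (fun t : ℝ => 1 / (δ + t)) (star j * j) * (star j * j) =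
          cfc (fun t : ℝ => 1 / (δ + t) * t) (star j * j) := by
        rw [cfc_mul _ (fun t : ℝ => t) _ hi continuousOn_id, cfc_id' ℝ (star j * j)]
      rw [h, ← cfc_const_one ℝ (star j * j), ← cfc_sub (fun _ => (1 : ℝ)) _ _ continuousOn_const hg]
      refine cfc_congr fun t ht => ?_
      have := hne t ht
      field_simp
      ring
    rw [this]
    exact I.mul_mem_left _ (I.mul_mem_left _ hj)
  · refine lt_of_pow_lt_pow_left₀ 2 hε.le (lt_of_le_of_lt (b := δ) ?_ (by
      rw [hδ']; linarith [sq_nonneg ε, pow_pos hε 2]))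
    refine norm_mul_cfc_star_mul_self_sq_le j hg hδ.le fun t ht => ?_
    rw [div_pow, mul_div_assoc', div_le_iff₀ (by positivity)]
    nlinarith [mul_nonneg hδ.le ht, mul_nonneg (mul_nonneg hδ.le ht) ht, pow_pos hδ 3,
      mul_nonneg (mul_nonneg hδ.le ht) hδ.le]

/-- The quotient of a unital C*-algebra by a closed star-invariant two-sided ideal. -/
@[reducible] noncomputable def quotientCStarAlgebra (I : Ideal A) [I.IsTwoSided]
    (hc : IsClosed (I : Set A)) (hs : ∀ a ∈ I, star a ∈ I) : CStarAlgebra (A ⧸ I) := by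
  haveI := hc
  letI st : Star (A ⧸ I) := ⟨Quotient.lift (fun a => Ideal.Quotient.mk I (star a)) fun a b hab => by
    have hab : a - b ∈ I := (Submodule.quotientRel_def I).mp hab
    refine Ideal.Quotient.eq.mpr ?_
    rw [← star_sub]
    exact hs _ hab⟩
  have hst : ∀ a : A, star (Ideal.Quotient.mk I a) = Ideal.Quotient.mk I (star a) := fun _ => rfl
  letI sr : StarRing (A ⧸ I) :=
    { star_involutive := by
        intro x
        obtain ⟨a, rfl⟩ := Ideal.Quotient.mk_surjective x
        rw [hst, hst, star_star]
      star_mul := by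
        intro x y
        obtain ⟨a, rfl⟩ := Ideal.Quotient.mk_surjective x
        obtain ⟨b, rfl⟩ := Ideal.Quotient.mk_surjective y
        rw [← map_mul, hst, hst, hst, star_mul, map_mul]
      star_add := by
        intro x y
        obtain ⟨a, rfl⟩ := Ideal.Quotient.mk_surjective x
        obtain ⟨b, rfl⟩ := Ideal.Quotient.mk_surjective y
        rw [← map_add, hst, hst, hst, star_add, map_add] }
  have hle : ∀ a : A, ‖Ideal.Quotient.mk I a‖ ≤ ‖a‖ := fun a => Submodule.Quotient.norm_mk_le (S := I) a
  have hlt : ∀ (x : A ⧸ I) {ε : ℝ}, 0 < ε → ∃ a, Ideal.Quotient.mk I a = x ∧ ‖a‖ < ‖x‖ + ε :=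
    fun x _ hε => Submodule.Quotient.norm_mk_lt x hε
  letI nr : NormedRing (A ⧸ I) :=
    { Submodule.Quotient.normedAddCommGroup I, Ideal.Quotient.ring I with
      dist_eq := dist_eq_norm_neg_add
      norm_mul_le := by
        intro x y
        have hev : ∀ ε : ℝ, 0 < ε → ‖x * y‖ ≤ (‖x‖ + ε) * (‖y‖ + ε) := fun ε hε => by
          obtain ⟨a, rfl, ha⟩ := hlt x hε
          obtain ⟨b, rfl, hb⟩ := hlt y hε
          rw [← map_mul]
          refine (hle _).trans ((norm_mul_le a b).trans ?_)
          exact mul_le_mul ha.le hb.le (norm_nonneg _) ((norm_nonneg a).trans ha.le)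
        have hT : Filter.Tendsto (fun ε : ℝ => (‖x‖ + ε) * (‖y‖ + ε)) (nhdsWithin 0 (Set.Ioi 0))
            (nhds ((‖x‖ + 0) * (‖y‖ + 0))) :=
          ((Continuous.tendsto (by fun_prop) 0).mono_left nhdsWithin_le_nhds)
        rw [add_zero, add_zero] at hT
        exact ge_of_tendsto hT (by filter_upwards [self_mem_nhdsWithin] with ε hε using hev ε hε) }
  haveI : CompleteSpace (A ⧸ I) := Submodule.Quotient.completeSpace I
  letI : NormedAlgebra ℂ (A ⧸ I) :=
    { Submodule.Quotient.normedSpace I ℂ, Ideal.Quotient.algebra ℂ with }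
  haveI : CStarRing (A ⧸ I) := by
    constructor
    intro x
    refine le_of_forall_pos_le_add fun ε hε => ?_
    obtain ⟨a, rfl⟩ := Ideal.Quotient.mk_surjective x
    rw [hst, ← map_mul]
    obtain ⟨b, hb, hbn⟩ := hlt (Ideal.Quotient.mk I (star a * a)) (half_pos hε)
    have hj : star a * a - b ∈ I := Ideal.Quotient.eq.mp hb.symm
    -- Multiplying a by w keeps its class, while w nearly annihilates the difference between a*a and
    -- its almost norm-minimal representative b. So ‖aw‖² is at most ‖b‖ + ε/2.
    obtain ⟨w, hw1, hws, hwI, hwj⟩ := exists_mul_mem_of_mem_ideal I hj (half_pos hε)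
    have h1 : Ideal.Quotient.mk I (a * w) = Ideal.Quotient.mk I a := by
      refine (Ideal.Quotient.eq.mpr ?_).symm
      have : a - a * w = a * (1 - w) := by rw [mul_sub, mul_one]
      rw [this]
      exact I.mul_mem_left _ hwI
    have h2 : ‖Ideal.Quotient.mk I a‖ ≤ ‖a * w‖ := h1 ▸ hle _
    have h3 : star (a * w) * (a * w) = w * (b * w) + w * ((star a * a - b) * w) := by
      rw [star_mul, hws.star_eq, ← mul_add, ← add_mul, add_sub_cancel]
      simp only [mul_assoc]
    calc _ ≤ ‖a * w‖ * ‖a * w‖ := mul_self_le_mul_self (norm_nonneg _) h2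
      _ = ‖star (a * w) * (a * w)‖ := CStarRing.norm_star_mul_self.symm
      _ ≤ ‖w * (b * w)‖ + ‖w * ((star a * a - b) * w)‖ := h3 ▸ norm_add_le _ _
      _ ≤ ‖b‖ + ε / 2 := by
        refine add_le_add ?_ ?_
        · refine (norm_mul_le _ _).trans ?_
          refine (mul_le_of_le_one_left (norm_nonneg _) hw1).trans ?_
          exact (norm_mul_le _ _).trans (mul_le_of_le_one_right (norm_nonneg _) hw1)
        · refine (norm_mul_le _ _).trans ?_
          exact (mul_le_of_le_one_left (norm_nonneg _) hw1).trans hwj.le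
      _ ≤ _ := by linarith
  haveI : StarModule ℂ (A ⧸ I) := by
    constructor
    intro c x
    obtain ⟨a, rfl⟩ := Ideal.Quotient.mk_surjective x
    change Ideal.Quotient.mk I (star (c • a)) = Ideal.Quotient.mk I (star c • star a)
    rw [star_smul]
  exact CStarAlgebra.mk

/-- Serves maps defined by choosing preimages, such as descents along a surjection or along
restriction of functions, where each identity is checked by independence of the choice. -/
theorem exists_starAlgHom_eq {A B : Type*} [Semiring A] [Algebra ℂ A] [Star A] [Semiring B]
    [Algebra ℂ B] [Star B] (q : A → B) (h1 : q 1 = 1)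
    (hmul : ∀ a b, q (a * b) = q a * q b) (hadd : ∀ a b, q (a + b) = q a + q b)
    (hsmul : ∀ (c : ℂ) a, q (c • a) = c • q a) (hstar : ∀ a, q (star a) = star (q a)) :
    ∃ φ : A →⋆ₐ[ℂ] B, ∀ a, φ a = q a :=
  ⟨{ AlgHom.ofLinearMap { toFun := q, map_add' := hadd, map_smul' := hsmul } h1 hmul with
      map_star' := hstar }, fun _ => rfl⟩

/-- Later arguments use only a surjection with kernel J onto some C*-algebra. The target stays in
the universe of A, as the universal property of the crossed product requires. -/
theorem exists_starAlgHom_ker_eq (J : TwoSidedIdeal A) (hc : IsClosed (J : Set A))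
    (hs : ∀ a ∈ J, star a ∈ J) :
    ∃ (Q : Type u) (_ : CStarAlgebra Q) (q : A →⋆ₐ[ℂ] Q), Function.Surjective q ∧
      ∀ a, q a = 0 ↔ a ∈ J := by
  have hJ : IsClosed ((TwoSidedIdeal.asIdeal J : Ideal A) : Set A) := hc
  obtain ⟨q, hq⟩ := @exists_starAlgHom_eq A (A ⧸ TwoSidedIdeal.asIdeal J) _ _ _ _
    (quotientCStarAlgebra (TwoSidedIdeal.asIdeal J) hJ hs).toAlgebra
    (quotientCStarAlgebra (TwoSidedIdeal.asIdeal J) hJ hs).toStar (Ideal.Quotient.mk _) rfl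
    (fun _ _ => rfl) (fun _ _ => rfl) (fun _ _ => rfl) fun _ => rfl
  refine ⟨_, _, q, fun b => ?_, fun a => ?_⟩
  · obtain ⟨a, ha⟩ := Ideal.Quotient.mk_surjective b
    exact ⟨a, (hq a).trans ha⟩
  rw [hq]
  exact Ideal.Quotient.eq_zero_iff_mem

/-- A `*`-homomorphism of C*-algebras induces an isometry on the quotient by its kernel. -/
theorem StarAlgHom.norm_apply_eq_infDist {B : Type*} [CStarAlgebra B] (φ : A →⋆ₐ[ℂ] B) (a : A) :
    ‖φ a‖ = Metric.infDist a {b | φ b = 0} := by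
  have hne : ({b | φ b = 0} : Set A).Nonempty := ⟨0, map_zero φ⟩
  have hle : ∀ b, ‖φ b‖ ≤ ‖b‖ := fun b => NonUnitalStarAlgHom.norm_apply_le φ b
  refine le_antisymm ((Metric.le_infDist hne).mpr fun b hb => ?_) ?_
  · rw [dist_eq_norm, ← sub_zero (φ a), ← (hb : φ b = 0), ← map_sub]
    exact hle _
  · rcases (norm_nonneg (φ a)).eq_or_lt with h0 | h0
    · rw [← h0, Metric.infDist_zero_of_mem]
      exact norm_eq_zero.mp h0.symm
    set c := ‖φ a‖ with hcdef
    -- The factor g(a*a) cuts a down to norm at most c. Since g = 1 on [0, c²], which contains the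
    -- spectrum of φ(a)*φ(a), φ sends g(a*a) to 1. Hence a - a g(a*a) is an element of the kernel
    -- within c of a.
    let g : ℝ → ℝ := fun t => c / max c √t
    have hpos : ∀ t, 0 < max c √t := fun t => lt_max_of_lt_left h0
    have hg : Continuous g :=
      continuous_const.div (continuous_const.max Real.continuous_sqrt) fun t => (hpos t).ne'
    have hφ : Continuous φ := AddMonoidHomClass.continuous_of_bound φ 1 fun b => by
      rw [one_mul]; exact hle b
    have hsa : IsSelfAdjoint (star a * a) := .star_mul_self a
    have hsb : IsSelfAdjoint (star (φ a) * φ a) := .star_mul_self (φ a)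
    have h1 : φ (cfc g (star a * a)) = 1 := by
      have hmap : φ (star a * a) = star (φ a) * φ a := by rw [map_mul, map_star]
      rw [StarAlgHom.map_cfc φ g (star a * a) hg.continuousOn hφ hsa (by rw [hmap]; exact hsb),
        hmap, ← cfc_one ℝ (star (φ a) * φ a)]
      refine cfc_congr fun t ht => ?_
      have hn : ‖t‖ ≤ c * c := by
        have : Nontrivial B := ⟨φ a, 0, norm_pos_iff.mp h0⟩
        rw [hcdef, ← CStarRing.norm_star_mul_self]
        exact spectrum.norm_le_norm_of_mem ht
      have ht' : √t ≤ c := Real.sqrt_le_iff.mpr ⟨h0.le, by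
        rw [sq]; exact (le_abs_self t).trans hn⟩
      simp only [g, max_eq_left ht', Pi.one_apply]
      exact div_self h0.ne'
    have h2 : ‖a * cfc g (star a * a)‖ ≤ c := by
      refine le_of_sq_le_sq ?_ h0.le
      refine norm_mul_cfc_star_mul_self_sq_le a hg.continuousOn (sq_nonneg c) fun t ht => ?_
      have := hpos t
      simp only [g]
      rw [div_pow, mul_div_assoc', div_le_iff₀ (by positivity), mul_comm]
      refine mul_le_mul_of_nonneg_left ?_ (sq_nonneg c)
      calc t = √t ^ 2 := (Real.sq_sqrt ht).symm
        _ ≤ _ := pow_le_pow_left₀ (Real.sqrt_nonneg t) (le_max_right _ _) 2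
    have hmem : a - a * cfc g (star a * a) ∈ {b | φ b = 0} := by
      simp only [Set.mem_ofPred_eq, map_sub, map_mul φ, h1, mul_one, sub_self]
    refine (Metric.infDist_le_dist_of_mem hmem).trans ?_
    rw [dist_eq_norm, sub_sub_cancel]
    exact h2

end Quotient

/-! ### Closed ideals, kernels and ranges -/

section ClosedIdeal

variable {A : Type u} [CStarAlgebra A]

theorem mem_closedIdeal_iff {a b : A} :
    b ∈ closedIdeal a ↔ ∀ J : TwoSidedIdeal A, IsClosed (J : Set A) → a ∈ J → b ∈ J := by
  simp only [closedIdeal, TwoSidedIdeal.mem_sInf, Set.mem_ofPred_eq, and_imp]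

theorem mem_closedIdeal_self (a : A) : a ∈ closedIdeal a :=
  mem_closedIdeal_iff.mpr fun _ _ h => h

theorem isClosed_closedIdeal (a : A) : IsClosed (closedIdeal a : Set A) := by
  have : (closedIdeal a : Set A) =
      ⋂ (J : TwoSidedIdeal A) (_ : IsClosed (J : Set A)) (_ : a ∈ J), (J : Set A) := by
    ext b
    simp only [SetLike.mem_coe, mem_closedIdeal_iff, Set.mem_iInter]
  rw [this]
  exact isClosed_iInter fun J => isClosed_iInter fun hJ => isClosed_iInter fun _ => hJ

/-- The adjoints of the elements of the ideal form again a closed two-sided ideal containing a = a*,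
so minimality applies. -/
theorem star_mem_closedIdeal {a : A} (ha : IsSelfAdjoint a) {b : A} (hb : b ∈ closedIdeal a) :
    star b ∈ closedIdeal a := by
  let J : TwoSidedIdeal A := .mk' {c | star c ∈ closedIdeal a}
    (by simp)
    (fun {x y} hx hy => by
      simp only [Set.mem_ofPred_eq, star_add] at *; exact TwoSidedIdeal.add_mem _ hx hy)
    (fun {x} hx => by simp only [Set.mem_ofPred_eq, star_neg] at *; exact TwoSidedIdeal.neg_mem _ hx)
    (fun {x y} hy => by
      simp only [Set.mem_ofPred_eq, star_mul] at *; exact TwoSidedIdeal.mul_mem_right _ _ _ hy)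
    (fun {x y} hx => by
      simp only [Set.mem_ofPred_eq, star_mul] at *; exact TwoSidedIdeal.mul_mem_left _ _ _ hx)
  have hJ : (J : Set A) = {c | star c ∈ closedIdeal a} := TwoSidedIdeal.coe_mk' ..
  have h : b ∈ (J : Set A) := mem_closedIdeal_iff.mp hb J
    (by rw [hJ]; exact (isClosed_closedIdeal a).preimage continuous_star)
    (by
      rw [← SetLike.mem_coe, hJ, Set.mem_ofPred_eq, ha.star_eq]
      exact mem_closedIdeal_self a)
  rw [hJ] at h
  exact h

theorem StarAlgHom.continuous_of_cstarAlgebra {B : Type*} [CStarAlgebra B] (φ : A →⋆ₐ[ℂ] B) :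
    Continuous φ :=
  AddMonoidHomClass.continuous_of_bound φ 1 fun b => by
    rw [one_mul]; exact NonUnitalStarAlgHom.norm_apply_le φ b

theorem StarAlgHom.isClosed_ker {B : Type*} [CStarAlgebra B] (φ : A →⋆ₐ[ℂ] B) :
    IsClosed (TwoSidedIdeal.ker φ : Set A) := by
  have hJ : (TwoSidedIdeal.ker φ : Set A) = φ ⁻¹' {0} := by
    ext c; simp [TwoSidedIdeal.mem_ker]
  rw [hJ]
  exact isClosed_singleton.preimage φ.continuous_of_cstarAlgebra

/-- φ factors through the quotient by its kernel as an injective `*`-homomorphism. Such a map is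
isometric, and an isometric image of a complete space is closed. -/
theorem StarAlgHom.isClosed_range {B : Type*} [CStarAlgebra B] (φ : A →⋆ₐ[ℂ] B) :
    IsClosed (Set.range φ) := by
  obtain ⟨Q, _, q, hq, hker⟩ := exists_starAlgHom_ker_eq (TwoSidedIdeal.ker φ) φ.isClosed_ker
    fun a ha => by
      rw [TwoSidedIdeal.mem_ker] at ha ⊢
      rw [map_star, ha, star_zero]
  have heq : ∀ a b, q a = q b → φ a = φ b := fun a b h => by
    rw [← sub_eq_zero, ← map_sub, hker, TwoSidedIdeal.mem_ker, map_sub, sub_eq_zero] at h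
    exact h
  have hs := Function.surjInv_eq hq
  obtain ⟨ψ, hψ⟩ := exists_starAlgHom_eq (fun b => φ (Function.surjInv hq b))
    (by rw [← map_one φ]; exact heq _ _ (by rw [hs, map_one]))
    (fun a b => by rw [← map_mul φ]; exact heq _ _ (by rw [map_mul, hs, hs, hs]))
    (fun a b => by rw [← map_add φ]; exact heq _ _ (by rw [map_add, hs, hs, hs]))
    (fun c a => by rw [← map_smul φ]; exact heq _ _ (by rw [map_smul, hs, hs]))
    (fun a => by rw [← map_star φ]; exact heq _ _ (by rw [map_star, hs, hs]))
  have hψq : ∀ a, ψ (q a) = φ a := fun a => by rw [hψ]; exact heq _ _ (hs _)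
  have hinj : Function.Injective ψ := by
    rw [injective_iff_map_eq_zero]
    intro b hb
    obtain ⟨a, rfl⟩ := hq b
    rw [hker, TwoSidedIdeal.mem_ker, ← hψq, hb]
  have hr : Set.range φ = Set.range ψ := by
    rw [← hq.range_comp ψ]
    exact congrArg Set.range (funext fun a => (hψq a).symm)
  rw [hr]
  exact (NonUnitalStarAlgHom.isometry ψ hinj).isClosedEmbedding.isClosed_range

theorem apply_eq_zero_of_mem_closedIdeal {B : Type*} [CStarAlgebra B] (φ : A →⋆ₐ[ℂ] B)
    {a : A} (ha : φ a = 0) {b : A} (hb : b ∈ closedIdeal a) : φ b = 0 :=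
  (TwoSidedIdeal.mem_ker φ).mp (mem_closedIdeal_iff.mp hb _ φ.isClosed_ker
    ((TwoSidedIdeal.mem_ker φ).mpr ha))

end ClosedIdeal

/-! ### The action of ℤ ⋊ ℕ^× on the additive boundary -/

namespace ZHat

/-- After cancelling the gcd, which is a nonzerodivisor in Ẑ, the two cofactors are coprime in ℤ and
hence, by Bézout, in Ẑ. -/
theorem natCast_dvd_mul_iff {l k : ℕ} (hk : k ≠ 0) (z : ZHat) :
    (l : ZHat) ∣ (k : ZHat) * z ↔ ((l / Nat.gcd l k : ℕ) : ZHat) ∣ z := by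
  have hg : Nat.gcd l k ≠ 0 := Nat.gcd_ne_zero_right hk
  have hl : (l : ZHat) = (Nat.gcd l k : ZHat) * ((l / Nat.gcd l k : ℕ) : ZHat) := by
    rw [← Nat.cast_mul, Nat.mul_div_cancel' (Nat.gcd_dvd_left l k)]
  have hk' : (k : ZHat) = (Nat.gcd l k : ZHat) * ((k / Nat.gcd l k : ℕ) : ZHat) := by
    rw [← Nat.cast_mul, Nat.mul_div_cancel' (Nat.gcd_dvd_right l k)]
  have hc : IsCoprime ((l / Nat.gcd l k : ℕ) : ZHat) ((k / Nat.gcd l k : ℕ) : ZHat) := by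
    have := (Nat.coprime_div_gcd_div_gcd (Nat.pos_of_ne_zero hg)).isCoprime.map
      (Int.castRingHom ZHat)
    simpa only [eq_intCast, Int.cast_natCast] using this
  constructor
  · rintro ⟨c, h⟩
    refine hc.dvd_of_dvd_mul_left ⟨c, natCast_mul_left_cancel hg ?_⟩
    rw [← mul_assoc, ← mul_assoc, ← hl, ← hk', h]
  · intro h
    have h1 : ((l / Nat.gcd l k : ℕ) : ZHat) ∣ ((k / Nat.gcd l k : ℕ) : ZHat) * z :=
      h.mul_left _
    have h2 := mul_dvd_mul_left (Nat.gcd l k : ZHat) h1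
    rwa [← mul_assoc, ← hl, ← hk'] at h2

theorem natCast_mul_dvd_mul_iff {k : ℕ} (hk : k ≠ 0) (l : ℕ) (z : ZHat) :
    ((k * l : ℕ) : ZHat) ∣ (k : ZHat) * z ↔ (l : ZHat) ∣ z := by
  constructor
  · rintro ⟨c, hc⟩
    exact ⟨c, natCast_mul_left_cancel hk (by rw [hc]; push_cast; ring)⟩
  · intro h
    rw [Nat.cast_mul]
    exact mul_dvd_mul_left _ h

end ZHat

theorem mem_typeB {r a : ZHat} {x : AffineMonoid ℕ} : x ∈ (typeB r a).carrier ↔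
    ((x.mul : ℕ) : ZHat) ∣ a ∧ ((x.mul : ℕ) : ZHat) ∣ r - (x.add : ZHat) := Iff.rfl

/-- `B(r, a)` determines, and depends only on, the natural divisors of `a` and the residues of `r`
modulo these divisors. -/
theorem typeB_eq_iff {r a r' a' : ZHat} : typeB r a = typeB r' a' ↔
    (∀ l : ℕ, l ≠ 0 → ((l : ZHat) ∣ a ↔ (l : ZHat) ∣ a')) ∧
      ∀ l : ℕ, l ≠ 0 → (l : ZHat) ∣ a → (l : ZHat) ∣ r - r' := by
  constructor
  · intro h
    have key : ∀ {r a r' a' : ZHat}, typeB r a = typeB r' a' → ∀ l : ℕ, l ≠ 0 → (l : ZHat) ∣ a →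
        (l : ZHat) ∣ a' ∧ (l : ZHat) ∣ r - r' := by
      intro r a r' a' h l hl hla
      -- With t a natural number congruent to r modulo l, the single element (t, l) tests both that
      -- l divides a' and that r' has the residue of r.
      obtain ⟨t, ht⟩ := ZHat.exists_nat hl r
      have hm : (⟨t, ⟨l, Nat.pos_of_ne_zero hl⟩⟩ : AffineMonoid ℕ) ∈ (typeB r a).carrier :=
        ⟨hla, ht⟩
      rw [h] at hm
      have h2 : (l : ZHat) ∣ r' - (t : ZHat) := hm.2
      refine ⟨hm.1, ?_⟩
      have := dvd_sub ht h2
      rwa [sub_sub_sub_cancel_right] at this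
    exact ⟨fun l hl => ⟨fun hla => (key h l hl hla).1, fun hla => (key h.symm l hl hla).1⟩,
      fun l hl hla => (key h l hl hla).2⟩
  · rintro ⟨h1, h2⟩
    refine NicaSpectrum.ext <| Set.ext fun x => ?_
    rw [mem_typeB, mem_typeB, ← h1 _ x.mul.ne_zero]
    refine and_congr_right fun ha => ?_
    have := h2 _ x.mul.ne_zero ha
    rw [← sub_add_sub_cancel r r' (x.add : ZHat), dvd_add_right this]

/-- The action of `ℤ ⋊ ℕ^×` on the parameters `(r, a)` of the points of the additive boundary. -/
noncomputable def affineAct (x : AffineMonoid ℤ) (q : ZHat × ZHat) : ZHat × ZHat :=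
  ((x.add : ZHat) + ((x.mul : ℕ) : ZHat) * q.1, ((x.mul : ℕ) : ZHat) * q.2)

theorem affineAct_mul (x y : AffineMonoid ℤ) (q : ZHat × ZHat) :
    affineAct (x * y) q = affineAct x (affineAct y q) := by
  refine Prod.ext ?_ ?_
  · simp only [affineAct, AffineMonoid.add_mul', AffineMonoid.mul_mul', PNat.mul_coe]
    push_cast; ring
  · simp only [affineAct, AffineMonoid.mul_mul', PNat.mul_coe]
    push_cast; ring

/-- The two directions are injectivity of the action on boundary points and its independence of the
parameters. With k the multiplicative part of x, injectivity tests the images with divisors kl;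
independence reduces a test by l on the images to one by l / gcd(l, k) on the original parameters.
-/
theorem typeB_affineAct_eq_iff (x : AffineMonoid ℤ) (q q' : ZHat × ZHat) :
    typeB (affineAct x q).1 (affineAct x q).2 = typeB (affineAct x q').1 (affineAct x q').2 ↔
      typeB q.1 q.2 = typeB q'.1 q'.2 := by
  have hk := x.mul.ne_zero
  have hsub : (affineAct x q).1 - (affineAct x q').1 = ((x.mul : ℕ) : ZHat) * (q.1 - q'.1) := by
    simp only [affineAct]; ring
  rw [typeB_eq_iff, typeB_eq_iff, hsub]
  simp only [affineAct]
  constructor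
  · rintro ⟨h1, h2⟩
    refine ⟨fun l hl => ?_, fun l hl hla => ?_⟩
    · simpa only [ZHat.natCast_mul_dvd_mul_iff hk] using h1 _ (mul_ne_zero hk hl)
    · have := h2 _ (mul_ne_zero hk hl) ((ZHat.natCast_mul_dvd_mul_iff hk l _).mpr hla)
      rwa [ZHat.natCast_mul_dvd_mul_iff hk] at this
  · rintro ⟨h1, h2⟩
    have hd : ∀ l : ℕ, l ≠ 0 → l / Nat.gcd l x.mul ≠ 0 := fun l hl =>
      (Nat.div_pos (Nat.le_of_dvd (Nat.pos_of_ne_zero hl) (Nat.gcd_dvd_left l _))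
        (Nat.pos_of_ne_zero (Nat.gcd_ne_zero_left hl))).ne'
    refine ⟨fun l hl => ?_, fun l hl => ?_⟩
    · simpa only [ZHat.natCast_dvd_mul_iff hk] using h1 _ (hd l hl)
    · simpa only [ZHat.natCast_dvd_mul_iff hk] using h2 _ (hd l hl)

/-- The parametrization of the additive boundary. -/
noncomputable def boundaryPoint (q : ZHat × ZHat) : additiveBoundary := ⟨typeB q.1 q.2, q, rfl⟩

theorem surjective_boundaryPoint : Function.Surjective boundaryPoint := by
  rintro ⟨_, q, rfl⟩
  exact ⟨q, rfl⟩

/-- A continuous surjection from a compact space to a Hausdorff one is a quotient map. Continuity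
and openness on the boundary can therefore be checked on the parameters (r, a). -/
theorem isQuotientMap_boundaryPoint : Topology.IsQuotientMap boundaryPoint := by
  have hc : Continuous boundaryPoint := continuous_typeB.subtype_mk _
  exact hc.isClosedMap.isQuotientMap hc surjective_boundaryPoint

noncomputable def boundaryAct (x : AffineMonoid ℤ) (ω : additiveBoundary) : additiveBoundary :=
  boundaryPoint (affineAct x (Function.surjInv surjective_boundaryPoint ω))

theorem boundaryAct_boundaryPoint (x : AffineMonoid ℤ) (q : ZHat × ZHat) :
    boundaryAct x (boundaryPoint q) = boundaryPoint (affineAct x q) := by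
  refine Subtype.ext ((typeB_affineAct_eq_iff x _ q).mpr ?_)
  exact congrArg Subtype.val (Function.surjInv_eq surjective_boundaryPoint (boundaryPoint q))

/-- Dividing the parameters produces a preimage; conversely, both conditions are unchanged when a
point gets other parameters. They are clopen in the parameters, which makes the images open. -/
theorem boundaryPoint_mem_range_boundaryAct {x : AffineMonoid ℤ} {q : ZHat × ZHat} :
    boundaryPoint q ∈ Set.range (boundaryAct x) ↔
      ((x.mul : ℕ) : ZHat) ∣ q.2 ∧ ((x.mul : ℕ) : ZHat) ∣ q.1 - (x.add : ZHat) := by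
  constructor
  · rintro ⟨η, hη⟩
    obtain ⟨q', rfl⟩ := surjective_boundaryPoint η
    rw [boundaryAct_boundaryPoint] at hη
    obtain ⟨h1, h2⟩ := typeB_eq_iff.mp (congrArg Subtype.val hη)
    have h3 : ((x.mul : ℕ) : ZHat) ∣ (affineAct x q').2 := dvd_mul_right _ _
    have h4 : ((x.mul : ℕ) : ZHat) ∣ (affineAct x q').1 - (x.add : ZHat) := by
      simp only [affineAct, add_sub_cancel_left]
      exact dvd_mul_right _ _
    refine ⟨(h1 _ x.mul.ne_zero).mp h3, ?_⟩
    have := dvd_sub h4 (h2 _ x.mul.ne_zero h3)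
    rwa [sub_sub_sub_cancel_left] at this
  · rintro ⟨⟨a, ha⟩, r, hr⟩
    refine ⟨boundaryPoint (r, a), ?_⟩
    rw [boundaryAct_boundaryPoint]
    congr 1
    refine Prod.ext ?_ ha.symm
    simp only [affineAct, ← hr, add_sub_cancel]

theorem isOpenEmbedding_boundaryAct (x : AffineMonoid ℤ) :
    Topology.IsOpenEmbedding (boundaryAct x) := by
  have hcont : Continuous (boundaryAct x) := by
    rw [isQuotientMap_boundaryPoint.continuous_iff]
    have : boundaryAct x ∘ boundaryPoint = boundaryPoint ∘ affineAct x :=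
      funext (boundaryAct_boundaryPoint x)
    rw [this]
    refine isQuotientMap_boundaryPoint.continuous.comp ?_
    unfold affineAct
    fun_prop
  have hinj : Function.Injective (boundaryAct x) := by
    intro ω η h
    obtain ⟨q, rfl⟩ := surjective_boundaryPoint ω
    obtain ⟨q', rfl⟩ := surjective_boundaryPoint η
    rw [boundaryAct_boundaryPoint, boundaryAct_boundaryPoint] at h
    exact Subtype.ext ((typeB_affineAct_eq_iff x q q').mp (congrArg Subtype.val h))
  refine ⟨(hcont.isClosedEmbedding hinj).isEmbedding, ?_⟩
  rw [← isQuotientMap_boundaryPoint.isOpen_preimage]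
  have : boundaryPoint ⁻¹' Set.range (boundaryAct x) =
      {q | ((x.mul : ℕ) : ZHat) ∣ q.2 ∧ ((x.mul : ℕ) : ZHat) ∣ q.1 - (x.add : ZHat)} :=
    Set.ext fun q => boundaryPoint_mem_range_boundaryAct
  rw [this]
  exact (((ZHat.isClopen_dvd x.mul.ne_zero).preimage continuous_snd).inter
    ((ZHat.isClopen_dvd x.mul.ne_zero).preimage (continuous_fst.sub continuous_const))).isOpen

/-- The action of `ℤ ⋊ ℕ^×` on the additive boundary. -/
noncomputable def boundaryAction : OpenAction (AffineMonoid ℤ) additiveBoundary where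
  act := boundaryAct
  one_act ω := by
    obtain ⟨q, rfl⟩ := surjective_boundaryPoint ω
    rw [boundaryAct_boundaryPoint]
    congr 1
    have h1 : (1 : AffineMonoid ℤ).add = 0 := rfl
    have h2 : (1 : AffineMonoid ℤ).mul = 1 := rfl
    refine Prod.ext ?_ ?_ <;> simp [affineAct, h1, h2]
  mul_act x y ω := by
    obtain ⟨q, rfl⟩ := surjective_boundaryPoint ω
    simp only [boundaryAct_boundaryPoint, affineAct_mul]
  isOpenEmbedding := isOpenEmbedding_boundaryAct

/-! ### Compatibility with the action on the whole spectrum -/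

theorem translate_typeB (x : AffineMonoid ℕ) (r a : ZHat) :
    NicaSpectrum.translate x (typeB r a) =
      typeB ((x.add : ZHat) + ((x.mul : ℕ) : ZHat) * r) (((x.mul : ℕ) : ZHat) * a) := by
  have hx := x.mul.ne_zero
  have hmem : ∀ z : AffineMonoid ℕ, x * z ∈ (typeB ((x.add : ZHat) + ((x.mul : ℕ) : ZHat) * r)
      (((x.mul : ℕ) : ZHat) * a)).carrier ↔ z ∈ (typeB r a).carrier := fun z => by
    rw [mem_typeB, mem_typeB, AffineMonoid.mul_mul', PNat.mul_coe,
      ZHat.natCast_mul_dvd_mul_iff hx]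
    have : (x.add : ZHat) + ((x.mul : ℕ) : ZHat) * r - ((x * z).add : ZHat) =
        ((x.mul : ℕ) : ZHat) * (r - (z.add : ZHat)) := by
      rw [AffineMonoid.add_mul']; push_cast; ring
    rw [this, ZHat.natCast_mul_dvd_mul_iff hx]
  refine NicaSpectrum.ext <| Set.ext fun y => ⟨?_, fun hy => ?_⟩
  · rintro ⟨z, hz, hyz⟩
    exact NicaSpectrum.hereditary _ _ _ hyz ((hmem z).mpr hz)
  -- Since x = x · 1 lies in the right-hand set, directedness bounds y above by an element of the
  -- form xz of that set.
  · obtain ⟨_, hw, ⟨z, rfl⟩, hyw⟩ := NicaSpectrum.directed _ _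
      ((hmem 1).mpr (NicaSpectrum.one_mem _)) y hy
    rw [mul_one] at hw hyw
    exact ⟨z, (hmem z).mp hw, hyw⟩

theorem boundaryAct_toInt (x : AffineMonoid ℕ) (ω : additiveBoundary) :
    (boundaryAct x.toInt ω : NicaSpectrum (AffineMonoid ℕ)) = NicaSpectrum.translate x ω := by
  obtain ⟨q, rfl⟩ := surjective_boundaryPoint ω
  rw [boundaryAct_boundaryPoint]
  change typeB _ _ = NicaSpectrum.translate x (typeB q.1 q.2)
  rw [translate_typeB]
  simp [affineAct, AffineMonoid.toInt]

theorem NicaSpectrum.mem_range_translate_iff {S : Type u} [Monoid S] [IsLeftCancelMul S]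
    {x : S} {ω : NicaSpectrum S} :
    ω ∈ Set.range (NicaSpectrum.translate x) ↔ x ∈ ω.carrier := by
  refine ⟨?_, fun hx => ?_⟩
  · rintro ⟨η, rfl⟩
    exact ⟨1, η.one_mem, by simp⟩
  · refine ⟨⟨{z | x * z ∈ ω.carrier}, ⟨1, by simpa using hx⟩,
      fun y z h hz => ω.hereditary _ _ (mul_dvd_mul_left x h) hz, fun y hy z hz => ?_⟩, ?_⟩
    · obtain ⟨_, ht, ⟨c, rfl⟩, c', hc'⟩ := ω.directed _ hy _ hz
      rw [mul_assoc] at ht hc'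
      rw [mul_assoc] at hc'
      exact ⟨y * c, ht, ⟨c, rfl⟩, c', mul_left_cancel hc'⟩
    · refine NicaSpectrum.ext <| Set.ext fun y => ⟨?_, fun hy => ?_⟩
      · rintro ⟨z, hz, hy⟩
        exact ω.hereditary _ _ hy hz
      · obtain ⟨_, ht, ⟨c, rfl⟩, hyt⟩ := ω.directed _ hx _ hy
        exact ⟨c, ht, hyt⟩

/-- Both sides say that x ∈ ω: a boundary point that is a translate of any point of Ω is one of a
boundary point. This is why extension by zero commutes with restriction to the boundary. -/
theorem coe_mem_range_translate_iff (x : AffineMonoid ℕ) (ω : additiveBoundary) :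
    (ω : NicaSpectrum (AffineMonoid ℕ)) ∈ Set.range (NicaSpectrum.translate x) ↔
      ω ∈ Set.range (boundaryAct x.toInt) := by
  constructor
  · intro h
    obtain ⟨q, rfl⟩ := surjective_boundaryPoint ω
    obtain ⟨h1, h2⟩ := mem_typeB.mp (NicaSpectrum.mem_range_translate_iff.mp h)
    exact boundaryPoint_mem_range_boundaryAct.mpr ⟨h1, by simpa [AffineMonoid.toInt] using h2⟩
  · rintro ⟨η, rfl⟩
    exact ⟨η, (boundaryAct_toInt x η).symm⟩

theorem push_restrict (x : AffineMonoid ℕ) (f : C(NicaSpectrum (AffineMonoid ℕ), ℂ)) :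
    ((NicaSpectrum.openAction (AffineMonoid ℕ)).push x f).restrict additiveBoundary =
      boundaryAction.push x.toInt (f.restrict additiveBoundary) := by
  ext ω
  change Function.extend (NicaSpectrum.translate x) f 0 ω =
    Function.extend (boundaryAct x.toInt) (f.restrict additiveBoundary) 0 ω
  by_cases h : ω ∈ Set.range (boundaryAct x.toInt)
  · obtain ⟨η, rfl⟩ := h
    rw [(isOpenEmbedding_boundaryAct _).injective.extend_apply, boundaryAct_toInt,
      (NicaSpectrum.isOpenEmbedding_translate x).injective.extend_apply]
    rfl
  · rw [Function.extend_apply' _ _ _ h,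
      Function.extend_apply' _ _ _ ((coe_mem_range_translate_iff x ω).not.mpr h)]
    rfl

/-! ### Recognizing boundary points inside the spectrum -/

theorem NicaSpectrum.mem_closure_of_forall_finite {S : Type u} [Monoid S]
    {T : Set (NicaSpectrum S)} {ω : NicaSpectrum S}
    (h : ∀ F : Finset S, ∃ η ∈ T, ∀ x ∈ F, x ∈ η.carrier ↔ x ∈ ω.carrier) : ω ∈ closure T := by
  rw [isInducing_indicator.closure_eq_preimage_closure_image, Set.mem_preimage, mem_closure_iff]
  intro o ho hω
  obtain ⟨F, u, hu, hsub⟩ := isOpen_pi_iff.mp ho _ hω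
  obtain ⟨η, hη, hηF⟩ := h F
  refine ⟨indicator η, hsub fun x hx => ?_, η, hη, rfl⟩
  have : indicator η x = indicator ω x :=
    decide_eq_decide.mpr (hηF x hx)
  rw [this]
  exact (hu x hx).2

/-- A point of the spectrum that is stable under `x ↦ x (1, 1)` is in the additive boundary. -/
theorem mem_additiveBoundary_of_forall_mul_mem {ω : NicaSpectrum (AffineMonoid ℕ)}
    (h : ∀ x ∈ ω.carrier, x * ⟨1, 1⟩ ∈ ω.carrier) : ω ∈ additiveBoundary := by
  -- Iterates (m, k)(1, 1) = (m + k, k).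
  have hbump : ∀ (n : ℕ) (x : AffineMonoid ℕ), x ∈ ω.carrier →
      (⟨x.add + x.mul * n, x.mul⟩ : AffineMonoid ℕ) ∈ ω.carrier := by
    intro n
    induction n with
    | zero => intro x hx; simpa using hx
    | succ n ih =>
      intro x hx
      convert ih _ (h x hx) using 1
      refine AffineMonoid.ext ?_ ?_
      · simp; ring
      · simp
  have hub : ∀ F : Finset (AffineMonoid ℕ), (∀ x ∈ F, x ∈ ω.carrier) →
      ∃ z ∈ ω.carrier, ∀ x ∈ F, x ∣ z := by
    intro F
    classical
    induction F using Finset.induction_on with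
    | empty => intro _; exact ⟨1, ω.one_mem, by simp⟩
    | insert a F ha ih =>
      intro hF
      obtain ⟨z, hz, hzF⟩ := ih fun x hx => hF x (Finset.mem_insert_of_mem hx)
      obtain ⟨w, hw, haw, hzw⟩ := ω.directed a (hF a (Finset.mem_insert_self a F)) z hz
      refine ⟨w, hw, fun x hx => ?_⟩
      rcases Finset.mem_insert.mp hx with rfl | hx
      · exact haw
      · exact (hzF x hx).trans hzw
  have hcl : IsClosed additiveBoundary := (isCompact_range continuous_typeB).isClosed
  rw [← hcl.closure_eq]
  refine NicaSpectrum.mem_closure_of_forall_finite fun F => ?_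
  classical
  obtain ⟨z, hz, hzF⟩ := hub (F.filter (· ∈ ω.carrier)) fun x hx => (Finset.mem_filter.mp hx).2
  -- For z = (m, k) in ω bounding F ∩ ω above, B(m, k) agrees with ω on F. The boundary is closed,
  -- so this approximation suffices.
  refine ⟨typeB z.add (z.mul : ℕ), ⟨(_, _), rfl⟩, fun x hx => ⟨?_, fun hxω => ?_⟩⟩
  · rintro ⟨h1, h2⟩
    have h1' := ZHat.natCast_dvd x.mul.ne_zero h1
    have h2' : ((x.mul : ℕ) : ℤ) ∣ (z.add : ℤ) - x.add :=
      ZHat.dvd_int x.mul.ne_zero (by push_cast; exact h2)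
    -- Membership in B(m, k) gives only congruences, while the order on ℕ ⋊ ℕ^× also requires the
    -- larger element to have the larger additive part. Shifting z by `x.add` multiples of k secures
    -- this without leaving ω.
    refine ω.hereditary _ _ ?_ (hbump x.add z hz)
    rw [AffineMonoid.dvd_iff]
    refine ⟨PNat.dvd_iff.mpr h1', ?_⟩
    have hle : x.add ≤ z.add + z.mul * x.add :=
      (Nat.le_mul_of_pos_left _ z.mul.pos).trans (Nat.le_add_left _ _)
    have h3 : (x.mul : ℕ) ∣ z.add + z.mul * x.add - x.add := by
      rw [← Int.natCast_dvd_natCast, Nat.cast_sub hle]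
      push_cast
      rw [add_sub_right_comm]
      exact dvd_add h2' ((Int.natCast_dvd_natCast.mpr h1').mul_right _)
    obtain ⟨n, hn⟩ := h3
    exact ⟨n, by simp only; omega⟩
  · obtain ⟨h1, n, hn⟩ := (AffineMonoid.dvd_iff _ _).mp
      (hzF x (Finset.mem_filter.mpr ⟨hx, hxω⟩))
    refine ⟨ZHat.natCast_dvd_of_dvd (PNat.dvd_iff.mp h1), ?_⟩
    rw [hn]
    push_cast
    rw [add_sub_cancel_left]
    exact dvd_mul_right _ _

/-! ### Formal rules for pushforwards, covariant pairs and affine elements -/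

namespace OpenAction

variable {S X : Type u} [Monoid S] [TopologicalSpace X] [CompactSpace X] [T2Space X]
  (α : OpenAction S X)

theorem push_apply_act (x : S) (f : C(X, ℂ)) (ω : X) : α.push x f (α.act x ω) = f ω :=
  (α.isOpenEmbedding x).injective.extend_apply _ _ _

theorem push_apply_of_notMem {x : S} (f : C(X, ℂ)) {ω : X} (h : ω ∉ Set.range (α.act x)) :
    α.push x f ω = 0 :=
  Function.extend_apply' _ _ _ h

theorem push_one (f : C(X, ℂ)) : α.push 1 f = f := by
  ext ω
  conv_lhs => rw [← α.one_act ω]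
  exact α.push_apply_act 1 f ω

theorem push_mul (x y : S) (f : C(X, ℂ)) : α.push (x * y) f = α.push x (α.push y f) := by
  ext ω
  by_cases hx : ω ∈ Set.range (α.act x)
  · obtain ⟨η, rfl⟩ := hx
    rw [push_apply_act]
    by_cases hy : η ∈ Set.range (α.act y)
    · obtain ⟨ζ, rfl⟩ := hy
      rw [push_apply_act, ← α.mul_act, push_apply_act]
    · rw [push_apply_of_notMem _ _ hy, push_apply_of_notMem]
      rintro ⟨ζ, hζ⟩
      rw [α.mul_act] at hζ
      exact hy ⟨ζ, (α.isOpenEmbedding x).injective hζ⟩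
  · rw [push_apply_of_notMem _ _ hx, push_apply_of_notMem]
    rintro ⟨ζ, rfl⟩
    exact hx ⟨α.act y ζ, (α.mul_act x y ζ).symm⟩

end OpenAction

namespace CovariantRep

variable {S X : Type u} [Monoid S] [TopologicalSpace X] [CompactSpace X] [T2Space X]
  {α : OpenAction S X} {A : Type u} [CStarAlgebra A] (ρ : CovariantRep α A)

theorem v_one : ρ.v 1 = 1 := by
  have h := ρ.isometry 1
  calc ρ.v 1 = star (ρ.v 1) * ρ.v 1 * ρ.v 1 := by rw [h, one_mul]
    _ = star (ρ.v 1) * ρ.v (1 * 1) := by rw [ρ.v_mul, mul_assoc]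
    _ = 1 := by rw [one_mul, h]

/-- An isometry with a right inverse is unitary. Applied to (n, 1) and (-n, 1), this makes
translations unitary over ℤ. -/
theorem star_v_of_mul_eq_one {x y : S} (h : x * y = 1) : star (ρ.v x) = ρ.v y := by
  calc star (ρ.v x) = star (ρ.v x) * ρ.v (x * y) := by rw [h, v_one, mul_one]
    _ = ρ.v y := by rw [ρ.v_mul, ← mul_assoc, ρ.isometry, one_mul]

theorem v_mul_star_v (x : S) : ρ.v x * star (ρ.v x) = ρ.π (α.push x 1) := by
  rw [← ρ.covariant, map_one, mul_one]

end CovariantRep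

namespace AffineMonoid

theorem mk_eq_mul {R : Type} [CommSemiring R] (m : R) (k : ℕ+) :
    (⟨m, k⟩ : AffineMonoid R) = ⟨m, 1⟩ * ⟨0, k⟩ :=
  AffineMonoid.ext (by simp) (one_mul _).symm

theorem mk_one_mul_mk_one {R : Type} [CommSemiring R] (m n : R) :
    (⟨m, 1⟩ * ⟨n, 1⟩ : AffineMonoid R) = ⟨m + n, 1⟩ :=
  AffineMonoid.ext (by simp) (one_mul _)

theorem one_def {R : Type} [CommSemiring R] : (1 : AffineMonoid R) = ⟨0, 1⟩ := rfl

theorem toInt_mul (x y : AffineMonoid ℕ) : (x * y).toInt = x.toInt * y.toInt :=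
  AffineMonoid.ext (by simp [toInt]) rfl

end AffineMonoid

-- Functions in the ideal generated by 1 - ss*

local notation "Ω" => NicaSpectrum (AffineMonoid ℕ)
local notation "γ" => NicaSpectrum.openAction (AffineMonoid ℕ)

theorem isSelfAdjoint_defectProjection : IsSelfAdjoint defectProjection := by
  simp [IsSelfAdjoint, defectProjection]

/-- The range projection of the isometry of x is the indicator of xΩ, so conjugating 1 - ss* by that
isometry gives the indicator of xΩ minus that of x(1,1)Ω. -/
theorem canonical_push_sub_push_mem (x : AffineMonoid ℕ) :
    (γ).canonical.π ((γ).push x 1 - (γ).push (x * ⟨1, 1⟩) 1) ∈ closedIdeal defectProjection := by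
  have h : (γ).canonical.π ((γ).push x 1 - (γ).push (x * ⟨1, 1⟩) 1) =
      (γ).canonical.v x * defectProjection * star ((γ).canonical.v x) := by
    rw [map_sub, ← CovariantRep.v_mul_star_v, ← CovariantRep.v_mul_star_v, CovariantRep.v_mul,
      star_mul, defectProjection]
    noncomm_ring
  rw [h]
  exact TwoSidedIdeal.mul_mem_right _ _ _
    (TwoSidedIdeal.mul_mem_left _ _ _ (mem_closedIdeal_self _))

/-- Functions vanishing on the additive boundary lie in the ideal generated by `1 - s s*`. -/
theorem canonical_mem_closedIdeal {f : C(Ω, ℂ)} (hf : f.restrict additiveBoundary = 0) :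
    (γ).canonical.π f ∈ closedIdeal defectProjection := by
  let K : Ideal C(Ω, ℂ) :=
    (TwoSidedIdeal.asIdeal (closedIdeal defectProjection)).comap (γ).canonical.π
  have hcont : Continuous (γ).canonical.π :=
    AddMonoidHomClass.continuous_of_bound _ 1 fun b => by
      rw [one_mul]; exact NonUnitalStarAlgHom.norm_apply_le _ b
  have hK : IsClosed (K : Set C(Ω, ℂ)) :=
    (isClosed_closedIdeal defectProjection).preimage hcont
  suffices h : f ∈ K from h
  -- A closed ideal of C(Ω) consists of all functions vanishing on its common zero set, so it is
  -- enough that this set lies in the boundary.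
  rw [← ContinuousMap.idealOfSet_ofIdeal_isClosed hK, ContinuousMap.mem_idealOfSet]
  intro ω hω
  rw [Set.mem_compl_iff, ContinuousMap.notMem_setOfIdeal] at hω
  suffices hB : ω ∈ additiveBoundary from DFunLike.congr_fun hf ⟨ω, hB⟩
  refine mem_additiveBoundary_of_forall_mul_mem fun x hx => ?_
  obtain ⟨η, hη⟩ := NicaSpectrum.mem_range_translate_iff.mpr hx
  rw [← NicaSpectrum.mem_range_translate_iff]
  by_contra hn
  -- If x ∈ ω but x(1,1) ∉ ω, this element of the ideal takes the value 1 at ω.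
  have h0 := hω (canonical_push_sub_push_mem x)
  rw [ContinuousMap.sub_apply, OpenAction.push_apply_of_notMem γ 1 hn, ← hη, sub_zero] at h0
  exact one_ne_zero ((OpenAction.push_apply_act γ x 1 η).symm.trans h0)

/-! ### Passing covariant pairs between ℕ ⋊ ℕ^× and ℤ ⋊ ℕ^× -/

/-- A covariant pair over the additive boundary restricts to one over the whole spectrum. -/
noncomputable def CovariantRep.restrictNat {A : Type} [CStarAlgebra A]
    (ρ : CovariantRep boundaryAction A) : CovariantRep γ A where
  π := ρ.π.comp (ContinuousMap.compStarAlgHom' ℂ ℂ ⟨Subtype.val, continuous_subtype_val⟩)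
  v x := ρ.v x.toInt
  isometry x := ρ.isometry _
  v_mul x y := by rw [AffineMonoid.toInt_mul, ρ.v_mul]
  covariant x f := (ρ.covariant x.toInt _).trans (congrArg ρ.π (push_restrict x f).symm)

section Extension

variable {Q : Type} [CStarAlgebra Q] (ρ : CovariantRep γ Q)

/-- By Tietze every function on the closed boundary extends to Ω, and two extensions differ by a
function that ρ kills. -/
theorem exists_boundary_starAlgHom
    (hπ : ∀ f : C(Ω, ℂ), f.restrict additiveBoundary = 0 → ρ.π f = 0) :
    ∃ π : C(additiveBoundary, ℂ) →⋆ₐ[ℂ] Q, ∀ f, π (f.restrict additiveBoundary) = ρ.π f := by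
  have hcl : IsClosed additiveBoundary := (isCompact_range continuous_typeB).isClosed
  choose E hE using ContinuousMap.exists_restrict_eq (Y := ℂ) hcl
  have heq : ∀ f g : C(Ω, ℂ), f.restrict additiveBoundary = g.restrict additiveBoundary →
      ρ.π f = ρ.π g := fun f g h => by
    rw [← sub_eq_zero, ← map_sub]
    refine hπ _ ?_
    ext ω
    exact sub_eq_zero.mpr (DFunLike.congr_fun h ω)
  have hE' : ∀ f ω, E f (ω : additiveBoundary) = f ω := fun f ω => DFunLike.congr_fun (hE f) ω
  obtain ⟨π, h⟩ := exists_starAlgHom_eq (fun f => ρ.π (E f))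
    (by
      rw [← map_one ρ.π]; refine heq _ _ (ContinuousMap.ext fun ω => ?_)
      simp [hE'])
    (fun f g => by
      rw [← map_mul ρ.π]; refine heq _ _ (ContinuousMap.ext fun ω => ?_)
      simp [hE'])
    (fun f g => by
      rw [← map_add ρ.π]; refine heq _ _ (ContinuousMap.ext fun ω => ?_)
      simp [hE'])
    (fun c f => by
      rw [← map_smul ρ.π]; refine heq _ _ (ContinuousMap.ext fun ω => ?_)
      simp [hE'])
    (fun f => by
      rw [← map_star ρ.π]; refine heq _ _ (ContinuousMap.ext fun ω => ?_)
      simp [hE'])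
  exact ⟨π, fun f => by rw [h]; exact heq _ _ (hE _)⟩

/-- A covariant pair over the spectrum of `ℕ ⋊ ℕ^×` in which `(1, 1)` acts by a unitary, and which
factors over the additive boundary, extends to `ℤ ⋊ ℕ^×`. -/
theorem exists_covariantRep_boundary
    (hπ : ∀ f : C(Ω, ℂ), f.restrict additiveBoundary = 0 → ρ.π f = 0)
    (hs : ρ.v ⟨1, 1⟩ * star (ρ.v ⟨1, 1⟩) = 1) :
    ∃ σ : CovariantRep boundaryAction Q, (∀ f, σ.π (f.restrict additiveBoundary) = ρ.π f) ∧
      ∀ x : AffineMonoid ℕ, σ.v x.toInt = ρ.v x := by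
  obtain ⟨π, hπr⟩ := exists_boundary_starAlgHom ρ hπ
  have hcl : IsClosed additiveBoundary := (isCompact_range continuous_typeB).isClosed
  let w : unitary Q := ⟨ρ.v ⟨1, 1⟩, ρ.isometry _, hs⟩
  let W : ℕ+ → Q := fun k => ρ.v ⟨0, k⟩
  have hw : ∀ n : ℕ, ((w ^ n : unitary Q) : Q) = ρ.v ⟨n, 1⟩ := by
    intro n
    induction n with
    | zero => rw [pow_zero]; exact ρ.v_one.symm
    | succ n ih =>
      rw [pow_succ, Submonoid.coe_mul, ih, ← ρ.v_mul, AffineMonoid.mk_one_mul_mk_one]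
  -- For m = 1 this is (0, k)(1, 1) = (k, 1)(0, k). Invertibility of w carries it to all integer
  -- powers, and it is what makes (m, k) ↦ w^m W_k multiplicative.
  have hcomm : ∀ (k : ℕ+) (m : ℤ),
      W k * ((w ^ m : unitary Q) : Q) = ((w ^ ((k : ℕ) * m) : unitary Q) : Q) * W k := by
    intro k m
    have h1 : SemiconjBy (W k) ((Unitary.toUnits w : Qˣ) : Q)
        ((Unitary.toUnits (w ^ (k : ℕ)) : Qˣ) : Q) := by
      change W k * ρ.v ⟨1, 1⟩ = ((w ^ (k : ℕ) : unitary Q) : Q) * W k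
      rw [hw, ← ρ.v_mul, ← ρ.v_mul]
      congr 1
      exact AffineMonoid.ext (by simp) (by simp)
    have h2 := h1.units_zpow_right m
    rw [← map_zpow, ← map_zpow, ← zpow_natCast, ← zpow_mul] at h2
    exact h2
  have hstar : ∀ m : ℤ, star ((w ^ m : unitary Q) : Q) = ((w ^ (-m) : unitary Q) : Q) :=
    fun m => by rw [zpow_neg, ← Unitary.star_eq_inv]; rfl
  have hadd : ∀ m n : ℤ, ((w ^ (m + n) : unitary Q) : Q) =
      ((w ^ m : unitary Q) : Q) * ((w ^ n : unitary Q) : Q) := fun m n => by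
    rw [zpow_add, Submonoid.coe_mul]
  have hnat : ∀ (x : AffineMonoid ℕ) (f : C(additiveBoundary, ℂ)),
      ρ.v x * π f * star (ρ.v x) = π (boundaryAction.push x.toInt f) := by
    intro x f
    obtain ⟨F, rfl⟩ := ContinuousMap.exists_restrict_eq hcl f
    rw [hπr, ρ.covariant, ← push_restrict, hπr]
  have hpush : ∀ (n : ℕ) (f : C(additiveBoundary, ℂ)), ((w ^ (n : ℤ) : unitary Q) : Q) * π f *
      ((w ^ (-(n : ℤ)) : unitary Q) : Q) = π (boundaryAction.push ⟨n, 1⟩ f) := fun n f => by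
    rw [← hstar, zpow_natCast, hw, hnat]; rfl
  have hint : ∀ (m : ℤ) (f : C(additiveBoundary, ℂ)), ((w ^ m : unitary Q) : Q) * π f *
      ((w ^ (-m) : unitary Q) : Q) = π (boundaryAction.push ⟨m, 1⟩ f) := by
    intro m f
    obtain ⟨n, rfl | rfl⟩ := m.eq_nat_or_neg
    · exact hpush n f
    -- Translation by n is invertible on the boundary, so covariance for -n follows by undoing
    -- covariance for n.
    · have h1 : f = boundaryAction.push ⟨n, 1⟩ (boundaryAction.push ⟨-n, 1⟩ f) := by
        rw [← OpenAction.push_mul, AffineMonoid.mk_one_mul_mk_one, add_neg_cancel,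
          ← AffineMonoid.one_def, OpenAction.push_one]
      conv_lhs => rw [h1, ← hpush n]
      have e1 : ((w ^ (-(n : ℤ)) : unitary Q) : Q) * ((w ^ (n : ℤ) : unitary Q) : Q) = 1 := by
        rw [← hadd, neg_add_cancel, zpow_zero]; rfl
      rw [neg_neg, mul_assoc, mul_assoc, mul_assoc, e1, mul_one, ← mul_assoc, e1, one_mul]
  refine ⟨{ π := π
            v := fun x => ((w ^ x.add : unitary Q) : Q) * W x.mul
            isometry := fun x => ?_
            v_mul := fun x y => ?_
            covariant := fun x f => ?_ }, hπr, fun x => ?_⟩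
  · rw [star_mul, mul_assoc, ← mul_assoc (star ((w ^ x.add : unitary Q) : Q)),
      Unitary.coe_star_mul_self, one_mul]
    exact ρ.isometry _
  · have hW : W (x * y).mul = W x.mul * W y.mul := by
      simp only [W]
      rw [← ρ.v_mul]
      exact congrArg ρ.v (AffineMonoid.ext (by simp) rfl)
    rw [hW, AffineMonoid.add_mul', hadd, mul_assoc, mul_assoc, ← mul_assoc (W x.mul), hcomm,
      mul_assoc]
  · have h0 : (⟨0, x.mul⟩ : AffineMonoid ℕ).toInt = ⟨0, x.mul⟩ := rfl
    have hx : x = ⟨x.add, 1⟩ * ⟨0, x.mul⟩ := AffineMonoid.mk_eq_mul x.add x.mul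
    have h1 : W x.mul * π f * star (W x.mul) = π (boundaryAction.push ⟨0, x.mul⟩ f) := by
      rw [← h0]; exact hnat _ f
    conv_rhs => rw [hx, OpenAction.push_mul, ← hint, ← h1, ← hstar]
    rw [star_mul]
    simp only [mul_assoc]
  · change ((w ^ (x.add : ℤ) : unitary Q) : Q) * W x.mul = ρ.v x
    rw [zpow_natCast, hw, ← ρ.v_mul, ← AffineMonoid.mk_eq_mul]

end Extension

/-! ### The homomorphism between the crossed products and its kernel -/

/-- Composition of the canonical covariant pair with a `*`-homomorphism. -/
noncomputable def CovariantRep.map {S X : Type u} [Monoid S] [TopologicalSpace X] [CompactSpace X]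
    [T2Space X] {α : OpenAction S X} {A B : Type u} [CStarAlgebra A] [CStarAlgebra B]
    (ρ : CovariantRep α A) (φ : A →⋆ₐ[ℂ] B) : CovariantRep α B where
  π := φ.comp ρ.π
  v x := φ (ρ.v x)
  isometry x := by rw [← map_star, ← map_mul, ρ.isometry, map_one]
  v_mul x y := by rw [ρ.v_mul, map_mul]
  covariant x f := by
    change φ (ρ.v x) * φ (ρ.π f) * star (φ (ρ.v x)) = φ (ρ.π _)
    rw [← map_star, ← map_mul, ← map_mul, ρ.covariant]

theorem exists_boundary_lift : ∃ φ : (γ).CrossedProduct →⋆ₐ[ℂ] boundaryAction.CrossedProduct,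
    (∀ f, φ ((γ).canonical.π f) = boundaryAction.canonical.π (f.restrict additiveBoundary)) ∧
      ∀ x, φ ((γ).canonical.v x) = boundaryAction.canonical.v x.toInt :=
  ((γ).existsUnique_lift boundaryAction.canonical.restrictNat).exists

/-- The range is closed, so it only has to contain the generators. Functions come from Tietze
extension, and (m, k) = (m, 1)(0, k) leaves only negative translations, which are adjoints of
positive ones. -/
theorem surjective_boundary_lift
    {φ : (γ).CrossedProduct →⋆ₐ[ℂ] boundaryAction.CrossedProduct}
    (hπ : ∀ f, φ ((γ).canonical.π f) = boundaryAction.canonical.π (f.restrict additiveBoundary))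
    (hv : ∀ x, φ ((γ).canonical.v x) = boundaryAction.canonical.v x.toInt) :
    Function.Surjective φ := by
  have hcl : IsClosed additiveBoundary := (isCompact_range continuous_typeB).isClosed
  have hnat : ∀ x : AffineMonoid ℕ, boundaryAction.canonical.v x.toInt ∈ φ.range :=
    fun x => ⟨_, hv x⟩
  have hle : StarAlgebra.adjoin ℂ (Set.range boundaryAction.canonical.π ∪
      Set.range boundaryAction.canonical.v) ≤ φ.range := by
    refine StarAlgebra.adjoin_le_iff.mpr ?_
    rintro _ (⟨f, rfl⟩ | ⟨x, rfl⟩)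
    · obtain ⟨F, rfl⟩ := ContinuousMap.exists_restrict_eq hcl f
      exact ⟨_, hπ F⟩
    · have hx : x = ⟨x.add, 1⟩ * ⟨0, x.mul⟩ := AffineMonoid.mk_eq_mul x.add x.mul
      rw [SetLike.mem_coe, hx, CovariantRep.v_mul]
      refine mul_mem ?_ (hnat ⟨0, x.mul⟩)
      obtain ⟨n, h | h⟩ := x.add.eq_nat_or_neg
      · rw [h]; exact hnat ⟨n, 1⟩
      · rw [h, ← CovariantRep.star_v_of_mul_eq_one (x := ⟨n, 1⟩) _
          (by rw [AffineMonoid.mk_one_mul_mk_one, add_neg_cancel]; rfl)]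
        exact star_mem (hnat ⟨n, 1⟩)
  intro b
  exact closure_minimal hle φ.isClosed_range (boundaryAction.dense_canonical b)

/-- The quotient map q by the ideal carries the canonical pair to one that extends to ℤ ⋊ ℕ^×, hence
to a homomorphism ψ of the boundary crossed product. As ψ ∘ φ and q agree on generators, uniqueness
gives q = ψ ∘ φ, so φ(b) = 0 forces q(b) = 0. -/
theorem boundary_lift_eq_zero_iff
    {φ : (γ).CrossedProduct →⋆ₐ[ℂ] boundaryAction.CrossedProduct}
    (hπ : ∀ f, φ ((γ).canonical.π f) = boundaryAction.canonical.π (f.restrict additiveBoundary))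
    (hv : ∀ x, φ ((γ).canonical.v x) = boundaryAction.canonical.v x.toInt)
    (b : (γ).CrossedProduct) : φ b = 0 ↔ b ∈ closedIdeal defectProjection := by
  refine ⟨fun hb => ?_, apply_eq_zero_of_mem_closedIdeal φ ?_⟩
  · obtain ⟨Q, _, q, -, hq⟩ := exists_starAlgHom_ker_eq (closedIdeal defectProjection)
      (isClosed_closedIdeal _) fun a => star_mem_closedIdeal isSelfAdjoint_defectProjection
    obtain ⟨σ, hσπ, hσv⟩ := exists_covariantRep_boundary ((γ).canonical.map q)
      (fun f hf => (hq _).mpr (canonical_mem_closedIdeal hf)) (by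
        have h := (hq _).mpr (mem_closedIdeal_self defectProjection)
        rw [defectProjection, map_sub, map_one, map_mul, map_star, sub_eq_zero] at h
        exact h.symm)
    obtain ⟨ψ, ⟨hψπ, hψv⟩, -⟩ := boundaryAction.existsUnique_lift σ
    have heq : ψ.comp φ = q :=
      ((γ).existsUnique_lift ((γ).canonical.map q)).unique
        ⟨fun f => by rw [StarAlgHom.comp_apply, hπ, hψπ, hσπ],
          fun x => by rw [StarAlgHom.comp_apply, hv, hψv, hσv]⟩
        ⟨fun _ => rfl, fun _ => rfl⟩
    rw [← hq, ← heq, StarAlgHom.comp_apply, hb, map_zero]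
  · rw [defectProjection, map_sub, map_one, map_mul, map_star, hv, sub_eq_zero,
      CovariantRep.star_v_of_mul_eq_one (y := ⟨-1, 1⟩), ← CovariantRep.v_mul]
    · exact (CovariantRep.v_one _).symm
    · rfl

theorem proposition1p3 :
    ∃ β : OpenAction (AffineMonoid ℤ) additiveBoundary,
      -- `β` extends the action of `ℕ ⋊ ℕ^×` on `Ω_B`
      (∀ (x : AffineMonoid ℕ) (ω : additiveBoundary),
        (β.act x.toInt ω : NicaSpectrum (AffineMonoid ℕ)) =
          (NicaSpectrum.openAction (AffineMonoid ℕ)).act x ω) ∧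
      -- `(m, k) (r, a) = (m + k r, k a)`
      (∀ (x : AffineMonoid ℤ) (r a : ZHat),
        (β.act x ⟨typeB r a, ⟨(r, a), rfl⟩⟩ : NicaSpectrum (AffineMonoid ℕ)) =
          typeB ((x.add : ZHat) + ((x.mul : ℕ) : ZHat) * r) (((x.mul : ℕ) : ZHat) * a)) ∧
      -- the isometric `*`-isomorphism from the quotient by `⟨1 - s s*⟩`
      ∃ e : (closedIdeal defectProjection).ringCon.Quotient ≃ₐ[ℂ] β.CrossedProduct,
        (∀ b, e ((closedIdeal defectProjection).ringCon.mk' (star b)) =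
          star (e ((closedIdeal defectProjection).ringCon.mk' b))) ∧
        (∀ b, ‖e ((closedIdeal defectProjection).ringCon.mk' b)‖ =
          Metric.infDist b (closedIdeal defectProjection : Set
            (NicaSpectrum.openAction (AffineMonoid ℕ)).CrossedProduct)) ∧
        (∀ f : C(NicaSpectrum (AffineMonoid ℕ), ℂ),
          e ((closedIdeal defectProjection).ringCon.mk'
            ((NicaSpectrum.openAction (AffineMonoid ℕ)).canonical.π f)) =
              β.canonical.π (f.restrict additiveBoundary)) ∧
        (∀ x : AffineMonoid ℕ,
          e ((closedIdeal defectProjection).ringCon.mk'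
            ((NicaSpectrum.openAction (AffineMonoid ℕ)).canonical.v x)) =
              β.canonical.v x.toInt) := by
  obtain ⟨φ, hπ, hv⟩ := exists_boundary_lift
  have hker := boundary_lift_eq_zero_iff hπ hv
  have hrel : ∀ a b, (closedIdeal defectProjection).ringCon a b ↔ φ a = φ b := fun a b => by
    rw [TwoSidedIdeal.rel_iff, ← hker, map_sub, sub_eq_zero]
  let e₀ := (closedIdeal defectProjection).ringCon.liftₐ φ.toAlgHom
    fun a b h => (hrel a b).mp h
  have he₀ : ∀ b, e₀ ((closedIdeal defectProjection).ringCon.mk' b) = φ b := fun _ => rfl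
  have hbij : Function.Bijective e₀ := by
    refine ⟨fun x y h => ?_, fun b => ?_⟩
    · obtain ⟨a, rfl⟩ := RingCon.mk'_surjective _ x
      obtain ⟨b, rfl⟩ := RingCon.mk'_surjective _ y
      rw [he₀, he₀] at h
      exact Quotient.sound ((hrel a b).mpr h)
    · obtain ⟨a, rfl⟩ := surjective_boundary_lift hπ hv b
      exact ⟨_, he₀ a⟩
  refine ⟨boundaryAction, boundaryAct_toInt, fun x r a => ?_, AlgEquiv.ofBijective e₀ hbij,
    fun b => map_star φ b, fun b => ?_, hπ, hv⟩
  · exact congrArg Subtype.val (boundaryAct_boundaryPoint x (r, a))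
  -- The norm of φ(b) is the distance from b to ker φ, and ker φ is the closed ideal.
  · refine (StarAlgHom.norm_apply_eq_infDist φ b).trans ?_
    congr 1
    exact Set.ext hker
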